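/- Model. A state $\theta\in\mathbb R$ has a diffuse prior (constant density on $\mathbb R$). A sender with $m\ge 1$ anecdotes observes $x_i=\theta+\epsilon_i$, $i\le m$, with $\epsilon_i$ i.i.d. from a noise distribution $F$, and has foresight, i.e. she also observes $y=\theta$. She sends one of her anecdotes, $\pi(x,y)\in\{x_1,\dots,x_m\}$ ($\pi$ measurable); the receiver sees only the message and takes the action $\alpha(\pi(x,y))\in\mathbb R$. The utilities from an action $a$ are $u_R=-(a-(\theta+M_R))^2$ and $u_S=-(a-(\theta+M_S))^2$, where the personal preferences $M_R,M_S\in\mathbb R$ are commonly known. In a perfect Bayesian equilibrium, $\alpha(z)$ maximizes the receiver's expected utility under the posterior distribution of $\theta$ given the message $z$, and for all $x,y$ the choice $\pi(x,y)$ maximizes, among the anecdotes, the sender's expected utility of the resulting action given $(x,y)$. The equilibrium is translation invariant if $\pi(x+\delta,y+\delta)=\pi(x,y)+\delta$ and $\alpha(z+\delta)=\alpha(z)+\delta$ for all $x,y,z,\delta$. The receiver is said to prefer one sender to another if the games with both senders have translation-invariant perfect Bayesian equilibria and, for every such equilibrium of each game and every state $\theta$, the receiver's expected utility given $\theta$ is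 strictly larger with the first sender. Proposition. Consider a receiver with personal preference $M_R$ who can choose between (a) a poorly informed sender with $n_0\ge 1$ anecdotes and the same personal preference $M_R$, and (b) an expert with $n>n_0$ anecdotes and personal preference $M_S\ne M_R$, both drawing anecdotes with the same noise distribution $F$. (i) If $F$ is a centred normal distribution with positive variance, then for every $n_0\ge 1$ there is $n_1$ such that for all $n>n_0$ with $n>n_1$, all $M_R$ and all $M_S\neq M_R$, the receiver prefers the expert. (ii) If $F$ is a centred Laplace distribution (density $\frac1{2b}e^{-|t|/b}$, $b>0$), then for every $n_0\ge 2$ and every $n>n_0$ there is $\Delta_0>0$ such that for all $M_R,M_S$ with $|M_S-M_R|>\Delta_0$ the receiver prefers the poorly informed sender. -/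

import Mathlib

open MeasureTheory ProbabilityTheory
open scoped NNReal ENNReal

noncomputable section

namespace Anecdotes

/-- Utility of an action `a` in state `θ` for a player with personal preference `M`. -/
def utility (M a θ : ℝ) : ℝ := -(a - (θ + M)) ^ 2

/-- Density of the centred Laplace distribution with scale `b`. -/
def laplacePDFReal (b x : ℝ) : ℝ := (2 * b)⁻¹ * Real.exp (-|x| / b)

/-- Law on `ℝ` with density `f`. -/
def lawOfDensity (f : ℝ → ℝ) : Measure ℝ := volume.withDensity fun x => ENNReal.ofReal (f x)

/-- Law of the noise profile `(ε₁, …, εₙ, γ)`: independent, every `εᵢ` with density `f`, and the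
noise `γ` of the side information with law `G`. -/
def noise (f : ℝ → ℝ) (G : Measure ℝ) (n : ℕ) : Measure ((Fin n → ℝ) × ℝ) :=
  (Measure.pi fun _ : Fin n => lawOfDensity f).prod G

/-- The foresight setting: `γ = 0` with probability one. -/
def foresight : Measure ℝ := Measure.dirac 0

/-- A (measurable) communication scheme: given the anecdotes `x` and the side information `y`,
the sender sends one of the anecdotes. -/
structure IsScheme {n : ℕ} (π : (Fin n → ℝ) → ℝ → ℝ) : Prop where
  measurable : Measurable (Function.uncurry π)
  selects : ∀ x y, ∃ i, π x y = x i

/-- The message sent in state `θ` under the realization `p = (ε, γ)` of the noise. -/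
def message {n : ℕ} (π : (Fin n → ℝ) → ℝ → ℝ) (θ : ℝ) (p : (Fin n → ℝ) × ℝ) : ℝ :=
  π (fun i => θ + p.1 i) (θ + p.2)

/-- Joint law of the state and the message. The prior on the state is diffuse, i.e. it has constant
density, so this is an infinite measure. -/
def jointLaw (f : ℝ → ℝ) (G : Measure ℝ) {n : ℕ} (π : (Fin n → ℝ) → ℝ → ℝ) : Measure (ℝ × ℝ) :=
  ((volume : Measure ℝ).prod (noise f G n)).map fun w => (w.1, message π w.1 w.2)

/-- `B x` is (a version of) the posterior distribution of the state given that the message is `x`: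
`B` disintegrates the joint law along the marginal law of the message. -/
def IsRationalBelief (f : ℝ → ℝ) (G : Measure ℝ) {n : ℕ} (π : (Fin n → ℝ) → ℝ → ℝ)
    (B : Kernel ℝ ℝ) : Prop :=
  IsMarkovKernel B ∧ ∀ A C : Set ℝ, MeasurableSet A → MeasurableSet C →
    jointLaw f G π (A ×ˢ C) = ∫⁻ x in C, B x A ∂(jointLaw f G π).snd

/-- The sender's posterior distribution of the state given `(x, y)`, by Bayes' rule under the
diffuse prior: given `y` alone it is the law of `y - γ`, and this is reweighted by the likelihood
`∏ᵢ f (xᵢ - θ)` of the anecdotes and normalized. -/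
def senderPosterior (f : ℝ → ℝ) (G : Measure ℝ) {n : ℕ} (x : Fin n → ℝ) (y : ℝ) : Measure ℝ :=
  let ν := (G.map fun γ => y - γ).withDensity fun θ => ∏ i, ENNReal.ofReal (f (x i - θ))
  (ν Set.univ)⁻¹ • ν

/-- The action `a` maximizes, among the actions in `S`, the expected utility of a player with
personal preference `M` and belief `μ` on the state (and this expected utility is finite). -/
def IsBestAction (M : ℝ) (μ : Measure ℝ) (S : Set ℝ) (a : ℝ) : Prop :=
  a ∈ S ∧ Integrable (utility M a) μ ∧
    ∀ b ∈ S, ∫ θ, utility M b θ ∂μ ≤ ∫ θ, utility M a θ ∂μ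

/-- Perfect Bayesian equilibrium of the game with anecdote noise density `f`, side information noise
law `G`, `n` anecdotes, and personal preferences `MS` (sender) and `MR` (receiver). -/
structure IsPBE (f : ℝ → ℝ) (G : Measure ℝ) {n : ℕ} (MS MR : ℝ)
    (π : (Fin n → ℝ) → ℝ → ℝ) (α : ℝ → ℝ) (B : Kernel ℝ ℝ) : Prop where
  scheme : IsScheme π
  receiver_best : ∀ x, IsBestAction MR (B x) Set.univ (α x)
  rational : IsRationalBelief f G π B
  sender_best : ∀ x y,
    IsBestAction MS (senderPosterior f G x y) (Set.range fun i => α (x i)) (α (π x y))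

/-- `(π, α)` is, with some belief function, a perfect Bayesian equilibrium, the communication scheme
`π` is translation invariant, and the action rule `α` is a translation. -/
def IsTranslationInvariantPBE (f : ℝ → ℝ) (G : Measure ℝ) {n : ℕ} (MS MR : ℝ)
    (π : (Fin n → ℝ) → ℝ → ℝ) (α : ℝ → ℝ) : Prop :=
  (∃ B : Kernel ℝ ℝ, IsPBE f G MS MR π α B) ∧
    (∀ x y δ, π (fun i => x i + δ) (y + δ) = π x y + δ) ∧
    (∀ x δ, α (x + δ) = α x + δ)

/-- Expected utility of the receiver in state `θ` under the strategies `π` and `α`. -/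
def receiverUtility (f : ℝ → ℝ) (G : Measure ℝ) {n : ℕ} (MR : ℝ)
    (π : (Fin n → ℝ) → ℝ → ℝ) (α : ℝ → ℝ) (θ : ℝ) : ℝ :=
  ∫ p, utility MR (α (message π θ p)) θ ∂(noise f G n)

/-- A receiver with personal preference `MR` (strictly) prefers to talk to a sender with `n`
anecdotes and personal preference `MS` rather than to one with `n'` anecdotes and personal
preference `MS'`: the two games have translation-invariant equilibria and, whichever of these are
played and whatever the state is, the receiver's expected utility is higher in the first game. -/
def ReceiverPrefers (f : ℝ → ℝ) (G : Measure ℝ) (MR : ℝ) (n : ℕ) (MS : ℝ) (n' : ℕ) (MS' : ℝ) :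
    Prop :=
  (∃ (π : (Fin n → ℝ) → ℝ → ℝ) (α : ℝ → ℝ), IsTranslationInvariantPBE f G MS MR π α) ∧
  (∃ (π' : (Fin n' → ℝ) → ℝ → ℝ) (α' : ℝ → ℝ), IsTranslationInvariantPBE f G MS' MR π' α') ∧
  ∀ (π : (Fin n → ℝ) → ℝ → ℝ) (α : ℝ → ℝ) (π' : (Fin n' → ℝ) → ℝ → ℝ) (α' : ℝ → ℝ),
    IsTranslationInvariantPBE f G MS MR π α → IsTranslationInvariantPBE f G MS' MR π' α' →
    ∀ θ, receiverUtility f G MR π' α' θ < receiverUtility f G MR π α θ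

end Anecdotes

end

noncomputable section

namespace Anecdotes

/-! ### Nearest-sample selections -/

/-! Everything reduces to comparing variances. An invariant action rule is `z ↦ z + c`, and a sender
with foresight then sends an anecdote nearest to `θ + r`, where `r = MS - c`. The error of the
message is a selection `C` from the noise sample, nearest to `r`. Under the diffuse prior the
posterior given `z` is the law of `z - C`, so the receiver debiases: `c = MR - E C`. Hence `r - E C
= MS - MR`, and the receiver's loss is exactly `Var C`
(`IsTranslationInvariantPBE.exists_selection`). Conversely, a minimiser of the expected squared
distance from `r` to the sample, tilted by `-2 (MS - MR) r`, solves this equation, so equilibria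
exist (`exists_isTranslationInvariantPBE`).

For Gaussian noise, extremes of large samples concentrate: `Var C` tends to zero uniformly in `r`
(`exists_forall_variance_lt_gaussian`). For the aligned sender `E C = r`, so the loss is a mean
squared distance to `r`, which is bounded below for a fixed sample size
(`IsNearestSelection.le_integral_sq`).

For Laplace noise, strict unimodality forces the aligned target to be `0`. Then `|C|` is a minimum
of exponentials, and the loss is at most `2 b ^ 2 / n₀ ^ 2 ≤ b ^ 2 / 2`. A large conflict pushes the
expert's `|r|` to infinity, where `C` behaves like a sample extreme; memoryless tails keep its
variance above `b ^ 2 / 2` (`exists_forall_lt_variance_laplace`). -/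

/-- A measurable selection, from a sample of size `n`, of an element nearest to `r`. -/
structure IsNearestSelection {n : ℕ} (r : ℝ) (C : (Fin n → ℝ) → ℝ) : Prop where
  measurable : Measurable C
  selects : ∀ x, ∃ i, C x = x i
  nearest : ∀ x i, |C x - r| ≤ |x i - r|

/-- An everywhere positive probability density with finite variance. -/
structure IsNoiseDensity (f : ℝ → ℝ) : Prop where
  measurable : Measurable f
  pos : ∀ x, 0 < f x
  isProbabilityMeasure : IsProbabilityMeasure (lawOfDensity f)
  memLp : MemLp id 2 (lawOfDensity f)

/-- Law of `n` independent samples with density `f`. -/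
abbrev sampleLaw (f : ℝ → ℝ) (n : ℕ) : Measure (Fin n → ℝ) :=
  Measure.pi fun _ : Fin n => lawOfDensity f

/-- Distance from `r` to the sample `x`. -/
def sampleDist {n : ℕ} [NeZero n] (r : ℝ) (x : Fin n → ℝ) : ℝ :=
  Finset.univ.inf' Finset.univ_nonempty fun i => |x i - r|

section sampleDist

variable {n : ℕ} [NeZero n]

lemma sampleDist_le (r : ℝ) (x : Fin n → ℝ) (i : Fin n) : sampleDist r x ≤ |x i - r| :=
  Finset.inf'_le _ (Finset.mem_univ i)

lemma exists_sampleDist_eq (r : ℝ) (x : Fin n → ℝ) : ∃ i, sampleDist r x = |x i - r| := by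
  obtain ⟨i, -, hi⟩ := Finset.exists_mem_eq_inf' (Finset.univ_nonempty (α := Fin n))
    fun i => |x i - r|
  exact ⟨i, hi⟩

lemma sampleDist_nonneg (r : ℝ) (x : Fin n → ℝ) : 0 ≤ sampleDist r x := by
  obtain ⟨i, hi⟩ := exists_sampleDist_eq r x
  rw [hi]; exact abs_nonneg _

lemma continuous_sampleDist : Continuous fun p : ℝ × (Fin n → ℝ) => sampleDist p.1 p.2 := by
  unfold sampleDist
  refine Continuous.finset_inf'_apply _ fun i _ => ?_
  fun_prop

lemma sampleDist_add (r : ℝ) (x : Fin n → ℝ) (δ : ℝ) :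
    sampleDist (r + δ) (fun i => x i + δ) = sampleDist r x := by
  simp [sampleDist]

/-- Send an anecdote nearest to `y + r`, the larger one in case of a tie. -/
def nearestScheme (r : ℝ) (x : Fin n → ℝ) (y : ℝ) : ℝ :=
  open Classical in
  if ∃ i, x i = y + r + sampleDist (y + r) x then y + r + sampleDist (y + r) x
  else y + r - sampleDist (y + r) x

lemma nearestScheme_selects (r : ℝ) (x : Fin n → ℝ) (y : ℝ) :
    ∃ i, nearestScheme r x y = x i := by
  unfold nearestScheme
  split_ifs with h
  · obtain ⟨i, hi⟩ := h
    exact ⟨i, hi.symm⟩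
  · obtain ⟨i, hi⟩ := exists_sampleDist_eq (y + r) x
    refine ⟨i, ?_⟩
    push Not at h
    rcases abs_cases (x i - (y + r)) with ⟨h1, -⟩ | ⟨h1, -⟩
    · exact absurd (by linarith) (h i)
    · linarith

lemma nearestScheme_nearest (r : ℝ) (x : Fin n → ℝ) (y : ℝ) (i : Fin n) :
    |nearestScheme r x y - (y + r)| ≤ |x i - (y + r)| := by
  have h : |nearestScheme r x y - (y + r)| = sampleDist (y + r) x := by
    have h0 := sampleDist_nonneg (y + r) x
    unfold nearestScheme
    split_ifs
    · rw [add_sub_cancel_left, abs_of_nonneg h0]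
    · rw [sub_sub_cancel_left, abs_neg, abs_of_nonneg h0]
  rw [h]; exact sampleDist_le _ _ _

lemma nearestScheme_add (r : ℝ) (x : Fin n → ℝ) (y δ : ℝ) :
    nearestScheme r (fun i => x i + δ) (y + δ) = nearestScheme r x y + δ := by
  have h : sampleDist (y + δ + r) (fun i => x i + δ) = sampleDist (y + r) x := by
    rw [add_right_comm]; exact sampleDist_add _ _ _
  have h2 : (∃ i, x i + δ = y + δ + r + sampleDist (y + r) x) ↔
      ∃ i, x i = y + r + sampleDist (y + r) x :=
    exists_congr fun i => ⟨fun h => by linarith, fun h => by linarith⟩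
  simp only [nearestScheme, h, h2]
  split_ifs <;> ring

lemma isScheme_nearestScheme (r : ℝ) : IsScheme (nearestScheme (n := n) r) where
  measurable := by
    have hd : Measurable fun p : (Fin n → ℝ) × ℝ => sampleDist (p.2 + r) p.1 :=
      (continuous_sampleDist.comp (by fun_prop : Continuous fun p : (Fin n → ℝ) × ℝ =>
        (p.2 + r, p.1))).measurable
    refine Measurable.ite ?_ (by fun_prop) (by fun_prop)
    rw [Set.ofPred_exists]
    exact MeasurableSet.iUnion fun i => measurableSet_eq_fun (by fun_prop) (by fun_prop)
  selects := nearestScheme_selects r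

lemma isNearestSelection_nearestScheme (r : ℝ) :
    IsNearestSelection r fun x : Fin n → ℝ => nearestScheme r x 0 where
  measurable := (isScheme_nearestScheme r).measurable.comp (by fun_prop : Measurable fun
    x : Fin n → ℝ => (x, (0 : ℝ)))
  selects x := nearestScheme_selects r x 0
  nearest x i := by simpa using nearestScheme_nearest r x 0 i

lemma IsNearestSelection.sq_eq {r : ℝ} {C : (Fin n → ℝ) → ℝ} (hC : IsNearestSelection r C)
    (x : Fin n → ℝ) : (C x - r) ^ 2 = sampleDist r x ^ 2 := by
  obtain ⟨i, hi⟩ := hC.selects x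
  obtain ⟨j, hj⟩ := exists_sampleDist_eq r x
  rw [← sq_abs]
  congr 1
  apply le_antisymm
  · rw [hj]; exact hC.nearest x j
  · rw [hi]; exact sampleDist_le _ _ _

end sampleDist

/-! ### Moments -/

lemma IsNoiseDensity.memLp_eval {f : ℝ → ℝ} (hf : IsNoiseDensity f) {n : ℕ} (i : Fin n) :
    MemLp (fun x : Fin n → ℝ => x i) 2 (sampleLaw f n) := by
  have := hf.isProbabilityMeasure
  exact hf.memLp.comp_measurePreserving (measurePreserving_eval (fun _ => lawOfDensity f) i)

lemma IsNoiseDensity.memLp_of_selects {f : ℝ → ℝ} (hf : IsNoiseDensity f) {n : ℕ}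
    {C : (Fin n → ℝ) → ℝ} (hm : Measurable C) (hs : ∀ x, ∃ i, C x = x i) :
    MemLp C 2 (sampleLaw f n) := by
  have h : MemLp (fun x : Fin n → ℝ => ∑ i, |x i|) 2 (sampleLaw f n) :=
    memLp_finsetSum _ fun i _ => (hf.memLp_eval i).abs
  refine h.mono hm.aestronglyMeasurable (ae_of_all _ fun x => ?_)
  obtain ⟨i, hi⟩ := hs x
  rw [hi, Real.norm_eq_abs, Real.norm_eq_abs]
  exact (Finset.single_le_sum (f := fun i => |x i|) (fun j _ => abs_nonneg _)
    (Finset.mem_univ i)).trans (le_abs_self _)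

/-- Bias-variance decomposition. It identifies the receiver's best action, drives the fixed-point
argument for existence, and bounds a variance by the second moment about any convenient centre. -/
lemma integral_sub_sq_eq {Ω : Type*} [MeasurableSpace Ω] {μ : Measure Ω} [IsProbabilityMeasure μ]
    {X : Ω → ℝ} (hX : MemLp X 2 μ) (a : ℝ) :
    ∫ ω, (X ω - a) ^ 2 ∂μ = ∫ ω, (X ω - ∫ ω', X ω' ∂μ) ^ 2 ∂μ + (∫ ω, X ω ∂μ - a) ^ 2 := by
  set m := ∫ ω, X ω ∂μ with hm
  have h1 : Integrable X μ := hX.integrable (by norm_num)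
  have h2 : Integrable (fun ω => (X ω - m) ^ 2) μ := (hX.sub (memLp_const m)).integrable_sq
  have h : ∀ ω, (X ω - a) ^ 2 = (X ω - m) ^ 2 + (2 * (m - a) * (X ω - m) + (m - a) ^ 2) :=
    fun ω => by ring
  simp_rw [h]
  rw [integral_add h2 (by fun_prop), integral_add (by fun_prop) (by fun_prop),
    integral_const_mul, integral_sub h1 (by fun_prop)]
  simp [← hm]

lemma isBestAction_univ_iff {ν : Measure ℝ} [IsProbabilityMeasure ν] (hν : MemLp id 2 ν)
    (M a : ℝ) : IsBestAction M ν Set.univ a ↔ a = ∫ θ, θ ∂ν + M := by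
  have key : ∀ b, ∫ θ, utility M b θ ∂ν =
      -(∫ θ, (θ - ∫ θ', θ' ∂ν) ^ 2 ∂ν + (∫ θ, θ ∂ν - (b - M)) ^ 2) := fun b => by
    have := integral_sub_sq_eq hν (b - M)
    simp only [id] at this
    rw [← this, ← integral_neg]
    congr 1; ext θ; unfold utility; ring
  constructor
  · rintro ⟨-, -, h⟩
    have := h (∫ θ, θ ∂ν + M) trivial
    rw [key, key] at this
    nlinarith [sq_nonneg (∫ θ, θ ∂ν - (a - M))]
  · rintro h
    refine ⟨trivial, ?_, fun b _ => ?_⟩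
    · have : Integrable (fun θ : ℝ => (θ - (a - M)) ^ 2) ν :=
        (hν.sub (memLp_const (a - M))).integrable_sq
      refine this.neg.congr (ae_of_all _ fun θ => ?_)
      simp only [Pi.neg_apply, utility]; ring
    · rw [key, key, h]
      nlinarith [sq_nonneg (∫ θ, θ ∂ν - (b - M))]

/-! ### Beliefs -/

/-- The law of `z - u` for `u` distributed according to `Q`, as a kernel. -/
def shiftKernel (Q : Measure ℝ) [SFinite Q] : Kernel ℝ ℝ where
  toFun z := Q.map fun u => z - u
  measurable' := by
    refine Measure.measurable_of_measurable_coe _ fun A hA => ?_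
    have : ∀ z : ℝ, Q.map (fun u => z - u) A = Q (Prod.mk z ⁻¹' ((fun p : ℝ × ℝ => p.1 - p.2) ⁻¹' A)) :=
      fun z => by rw [Measure.map_apply (by fun_prop) hA]; rfl
    simp_rw [this]
    exact measurable_measure_prodMk_left (hA.preimage (by fun_prop))

lemma shiftKernel_apply (Q : Measure ℝ) [SFinite Q] (z : ℝ) :
    shiftKernel Q z = Q.map fun u => z - u := rfl

instance (Q : Measure ℝ) [IsProbabilityMeasure Q] : IsMarkovKernel (shiftKernel Q) :=
  ⟨fun z => by rw [shiftKernel_apply]; exact Measure.isProbabilityMeasure_map (by fun_prop)⟩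

/-- Joint law of a Lebesgue distributed `θ` and `θ + u`, where `u` has law `Q`. -/
def shiftJoint (Q : Measure ℝ) : Measure (ℝ × ℝ) :=
  ((volume : Measure ℝ).prod Q).map fun p => (p.1, p.1 + p.2)

/-- For each fixed `u` the substitution `θ = z - u` preserves Lebesgue measure. Integrating over `u`
and exchanging the order leaves a Lebesgue-distributed message with `z - u` as posterior. -/
lemma shiftJoint_prod (Q : Measure ℝ) [IsProbabilityMeasure Q] {A C : Set ℝ}
    (hA : MeasurableSet A) (hC : MeasurableSet C) :
    shiftJoint Q (A ×ˢ C) = ∫⁻ z in C, shiftKernel Q z A := by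
  set F : ℝ → ℝ → ℝ≥0∞ := fun θ z => A.indicator 1 θ * C.indicator 1 z with hF
  have hFm : Measurable (Function.uncurry F) :=
    ((measurable_one.indicator hA).comp measurable_fst).mul
      ((measurable_one.indicator hC).comp measurable_snd)
  have h1 : shiftJoint Q (A ×ˢ C) = ∫⁻ p, F p.1 (p.1 + p.2) ∂((volume : Measure ℝ).prod Q) := by
    rw [← lintegral_indicator_one (hA.prod hC), shiftJoint,
      lintegral_map (measurable_one.indicator (hA.prod hC)) (by fun_prop)]
    refine lintegral_congr fun p => ?_
    simp [hF, Set.indicator_prod_one]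
  have hm1 : Measurable fun p : ℝ × ℝ => F p.1 (p.1 + p.2) :=
    hFm.comp (by fun_prop : Measurable fun p : ℝ × ℝ => (p.1, p.1 + p.2))
  have hm2 : Measurable fun p : ℝ × ℝ => F (p.1 - p.2) p.1 :=
    hFm.comp (by fun_prop : Measurable fun p : ℝ × ℝ => (p.1 - p.2, p.1))
  rw [h1, lintegral_prod_symm _ hm1.aemeasurable]
  have h2 : ∀ u : ℝ, ∫⁻ θ, F θ (θ + u) = ∫⁻ z, F (z - u) z := fun u => by
    simpa using lintegral_add_right_eq_self (fun z => F (z - u) z) u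
  simp_rw [h2]
  rw [← lintegral_prod_symm (μ := (volume : Measure ℝ)) (ν := Q) (fun p => F (p.1 - p.2) p.1)
    hm2.aemeasurable, lintegral_prod _ hm2.aemeasurable, ← lintegral_indicator hC]
  refine lintegral_congr fun z => ?_
  have hm3 : Measurable fun u : ℝ => A.indicator (1 : ℝ → ℝ≥0∞) (z - u) :=
    (measurable_one.indicator hA).comp (by fun_prop)
  simp only [hF]
  rw [lintegral_mul_const _ hm3]
  have : ∫⁻ u, A.indicator (1 : ℝ → ℝ≥0∞) (z - u) ∂Q = shiftKernel Q z A := by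
    rw [← lintegral_indicator_one hA, shiftKernel_apply,
      lintegral_map (measurable_one.indicator hA) (by fun_prop)]
  rw [this]
  by_cases hz : z ∈ C <;> simp [hz]

lemma shiftJoint_snd (Q : Measure ℝ) [IsProbabilityMeasure Q] : (shiftJoint Q).snd = volume := by
  ext C hC
  rw [Measure.snd_apply hC, ← Set.univ_prod, shiftJoint_prod Q MeasurableSet.univ hC]
  simp

/-- Two disintegrations of the joint law agree somewhere. -/
lemma exists_eq_shiftKernel (Q : Measure ℝ) [IsProbabilityMeasure Q] (B : Kernel ℝ ℝ)
    [IsMarkovKernel B] (hB : ∀ A C : Set ℝ, MeasurableSet A → MeasurableSet C →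
      shiftJoint Q (A ×ˢ C) = ∫⁻ z in C, B z A ∂(shiftJoint Q).snd) :
    ∃ z, B z = shiftKernel Q z := by
  -- A disintegration is unique only almost everywhere. Testing on countably many rational
  -- half-lines gives a common null set, and these half-lines determine a measure.
  have h : ∀ q : ℚ, ∀ᵐ z : ℝ, B z (Set.Iic (q : ℝ)) = shiftKernel Q z (Set.Iic (q : ℝ)) := by
    intro q
    refine ae_eq_of_forall_setLIntegral_eq_of_sigmaFinite
      (Kernel.measurable_coe _ measurableSet_Iic) (Kernel.measurable_coe _ measurableSet_Iic)
      fun C hC _ => ?_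
    rw [← shiftJoint_prod Q measurableSet_Iic hC, hB _ _ measurableSet_Iic hC, shiftJoint_snd]
  obtain ⟨z, hz⟩ := (ae_all_iff.2 h).exists
  refine ⟨z, ext_of_generate_finite _ ((BorelSpace.measurable_eq (α := ℝ)).trans
    Real.borel_eq_generateFrom_Iic_rat) Real.isPiSystem_Iic_rat ?_ (by simp)⟩
  intro s hs
  obtain ⟨q, hq⟩ := Set.mem_iUnion.1 hs
  rw [Set.mem_singleton_iff.1 hq]
  exact hz q

/-! ### Translation-invariant equilibria under foresight -/

lemma noise_foresight (f : ℝ → ℝ) [IsProbabilityMeasure (lawOfDensity f)] (n : ℕ) :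
    noise f foresight n = (sampleLaw f n).map fun x => (x, (0 : ℝ)) :=
  Measure.prod_dirac 0

lemma message_foresight {n : ℕ} {π : (Fin n → ℝ) → ℝ → ℝ}
    (hπ : ∀ x y δ, π (fun i => x i + δ) (y + δ) = π x y + δ) (θ : ℝ) (x : Fin n → ℝ) :
    message π θ (x, 0) = θ + π x 0 := by
  have := hπ x 0 θ
  simp only [message, add_comm θ]
  exact this

lemma jointLaw_foresight {f : ℝ → ℝ} [IsProbabilityMeasure (lawOfDensity f)] {n : ℕ}
    {π : (Fin n → ℝ) → ℝ → ℝ} (hs : IsScheme π)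
    (hπ : ∀ x y δ, π (fun i => x i + δ) (y + δ) = π x y + δ) :
    jointLaw f foresight π = shiftJoint ((sampleLaw f n).map fun x => π x 0) := by
  have hm0 : Measurable fun x : Fin n → ℝ => π x 0 :=
    hs.measurable.comp (by fun_prop : Measurable fun x : Fin n → ℝ => (x, (0 : ℝ)))
  have hm1 : Measurable fun w : ℝ × ((Fin n → ℝ) × ℝ) => (w.1, message π w.1 w.2) := by
    refine measurable_fst.prodMk ?_
    exact hs.measurable.comp (by fun_prop : Measurable fun w : ℝ × ((Fin n → ℝ) × ℝ) =>
      ((fun i => w.1 + w.2.1 i), w.1 + w.2.2))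
  have h1 := Measure.map_prod_map (volume : Measure ℝ) (sampleLaw f n)
    (measurable_id (α := ℝ)) (by fun_prop : Measurable fun x : Fin n → ℝ => (x, (0 : ℝ)))
  have h2 := Measure.map_prod_map (volume : Measure ℝ) (sampleLaw f n)
    (measurable_id (α := ℝ)) hm0
  rw [Measure.map_id] at h1 h2
  rw [jointLaw, noise_foresight, h1, shiftJoint, h2, Measure.map_map hm1 (by fun_prop),
    Measure.map_map (by fun_prop) (by fun_prop)]
  congr 1
  ext p
  · rfl
  · simpa using message_foresight hπ p.1 p.2

/-- The likelihood only multiplies the point mass at `y` by a constant. Positivity of `f` makes that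
constant nonzero, so normalization removes it for every `x` and `y`. -/
lemma senderPosterior_foresight {f : ℝ → ℝ} (hf : ∀ x, 0 < f x) {n : ℕ} (x : Fin n → ℝ) (y : ℝ) :
    senderPosterior f foresight x y = Measure.dirac y := by
  have h : ∀ i, ENNReal.ofReal (f (x i - y)) ≠ 0 := fun i => by simpa using hf _
  simp only [senderPosterior, foresight]
  have hmap : Measure.map (fun γ => y - γ) (Measure.dirac 0) = Measure.dirac y := by
    rw [Measure.map_dirac' (by fun_prop), sub_zero]
  rw [hmap, dirac_withDensity]
  simp only [Measure.smul_apply, measure_univ, smul_eq_mul, mul_one, smul_smul]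
  rw [ENNReal.inv_mul_cancel, one_smul]
  · exact Finset.prod_ne_zero_iff.2 fun i _ => h i
  · exact ENNReal.prod_ne_top fun i _ => ENNReal.ofReal_ne_top

lemma isBestAction_dirac_iff (M y : ℝ) (S : Set ℝ) (a : ℝ) :
    IsBestAction M (Measure.dirac y) S a ↔ a ∈ S ∧ ∀ b ∈ S, |a - (y + M)| ≤ |b - (y + M)| := by
  have hi : Integrable (utility M a) (Measure.dirac y) := integrable_dirac (by simp)
  simp only [IsBestAction, integral_dirac, hi, true_and, utility, neg_le_neg_iff, sq_le_sq]

/-- Under foresight, an action rule that is a translation makes sending a nearest anecdote to a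
target optimal. -/
lemma sender_best_iff {f : ℝ → ℝ} (hf : ∀ x, 0 < f x) {n : ℕ} {MS c r : ℝ} (hr : r = MS - c)
    {π : (Fin n → ℝ) → ℝ → ℝ} (hs : ∀ x y, ∃ i, π x y = x i) (x : Fin n → ℝ) (y : ℝ) :
    IsBestAction MS (senderPosterior f foresight x y) (Set.range fun i => x i + c) (π x y + c) ↔
      ∀ i, |π x y - (y + r)| ≤ |x i - (y + r)| := by
  rw [senderPosterior_foresight hf, isBestAction_dirac_iff]
  obtain ⟨j, hj⟩ := hs x y
  have h : ∀ z : ℝ, z + c - (y + MS) = z - (y + r) := fun z => by rw [hr]; ring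
  simp only [Set.forall_mem_range, h, and_iff_right_iff_imp]
  exact fun _ => ⟨j, by simp [hj]⟩

lemma memLp_shiftKernel {f : ℝ → ℝ} (hf : IsNoiseDensity f) {n : ℕ} {C : (Fin n → ℝ) → ℝ}
    (hm : Measurable C) (hs : ∀ x, ∃ i, C x = x i) [SFinite ((sampleLaw f n).map C)] (z : ℝ) :
    MemLp id 2 (shiftKernel ((sampleLaw f n).map C) z) ∧
      ∫ θ, θ ∂(shiftKernel ((sampleLaw f n).map C) z) = z - ∫ x, C x ∂(sampleLaw f n) := by
  have := hf.isProbabilityMeasure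
  have hC := hf.memLp_of_selects hm hs
  rw [shiftKernel_apply, Measure.map_map (by fun_prop) hm]
  have hm' : Measurable ((fun u => z - u) ∘ C) := (by fun_prop : Measurable fun u => z - u).comp hm
  constructor
  · rw [memLp_map_measure_iff measurable_id.aestronglyMeasurable hm'.aemeasurable]
    exact (memLp_const z).sub hC
  · rw [integral_map (f := fun θ : ℝ => θ) hm'.aemeasurable measurable_id.aestronglyMeasurable]
    simp only [Function.comp]
    rw [integral_sub (by fun_prop) (hC.integrable (by norm_num))]
    simp

/-- Every translation-invariant equilibrium is given by a nearest-sample selection. -/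
theorem IsTranslationInvariantPBE.exists_selection {f : ℝ → ℝ} (hf : IsNoiseDensity f) {n : ℕ}
    {MS MR : ℝ} {π : (Fin n → ℝ) → ℝ → ℝ} {α : ℝ → ℝ}
    (h : IsTranslationInvariantPBE f foresight MS MR π α) :
    ∃ (r : ℝ) (C : (Fin n → ℝ) → ℝ), IsNearestSelection r C ∧
      r - ∫ x, C x ∂(sampleLaw f n) = MS - MR ∧
      ∀ θ, receiverUtility f foresight MR π α θ =
        -∫ x, (C x - ∫ x', C x' ∂(sampleLaw f n)) ^ 2 ∂(sampleLaw f n) := by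
  have := hf.isProbabilityMeasure
  obtain ⟨⟨B, hB⟩, hπ, hα⟩ := h
  set C : (Fin n → ℝ) → ℝ := fun x => π x 0 with hCdef
  set c := α 0 with hc
  have hα' : ∀ z, α z = z + c := fun z => by
    have := hα 0 z; rw [zero_add] at this; rw [this, add_comm]
  have hm : Measurable C := hB.scheme.measurable.comp
    (by fun_prop : Measurable fun x : Fin n → ℝ => (x, (0 : ℝ)))
  have hs : ∀ x, ∃ i, C x = x i := fun x => hB.scheme.selects x 0
  have hQ : IsProbabilityMeasure ((sampleLaw f n).map C) :=
    Measure.isProbabilityMeasure_map hm.aemeasurable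
  obtain ⟨hBm, hBr⟩ := hB.rational
  rw [jointLaw_foresight hB.scheme hπ] at hBr
  -- One message with the computed belief suffices: `α` is a translation, so its value there
  -- determines `c`.
  obtain ⟨z, hz⟩ := exists_eq_shiftKernel _ B hBr
  obtain ⟨hL, hmean⟩ := memLp_shiftKernel hf hm hs z
  have hbest := hB.receiver_best z
  rw [hz, isBestAction_univ_iff hL, hmean, hα'] at hbest
  have hcr : c = MR - ∫ x, C x ∂(sampleLaw f n) := by linarith
  refine ⟨MS - c, C, ⟨hm, hs, fun x i => ?_⟩, by rw [hcr]; ring, fun θ => ?_⟩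
  · have := hB.sender_best x 0
    simp only [hα'] at this
    simpa using (sender_best_iff hf.pos rfl hB.scheme.selects x 0).1 this i
  · have hmeas : Measurable fun p : (Fin n → ℝ) × ℝ => utility MR (α (message π θ p)) θ := by
      have : Measurable fun p : (Fin n → ℝ) × ℝ => message π θ p :=
        hB.scheme.measurable.comp (by fun_prop : Measurable fun w : (Fin n → ℝ) × ℝ =>
          ((fun i => θ + w.1 i), θ + w.2))
      simp only [utility, hα']
      fun_prop
    rw [receiverUtility, noise_foresight,
      integral_map (by fun_prop) hmeas.aestronglyMeasurable, ← integral_neg]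
    congr 1; ext x
    rw [message_foresight hπ, hα', utility, hcr]
    ring

/-! ### Existence of equilibria -/

/-- The expected squared distance to the sample, tilted by a linear term, has a minimiser. -/
lemma exists_minimiser_sampleDist {f : ℝ → ℝ} (hf : IsNoiseDensity f) {n : ℕ} [NeZero n] (Δ : ℝ) :
    ∃ r, ∀ s, ∫ x, sampleDist r x ^ 2 ∂(sampleLaw f n) - 2 * Δ * r ≤
      ∫ x, sampleDist s x ^ 2 ∂(sampleLaw f n) - 2 * Δ * s := by
  have := hf.isProbabilityMeasure
  have hL := hf.memLp_eval (0 : Fin n)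
  have hsel : ∀ s : ℝ, MemLp (fun x : Fin n → ℝ => sampleDist s x) 2 (sampleLaw f n) := fun s => by
    refine (hL.sub (memLp_const s)).mono
      (continuous_sampleDist.comp (by fun_prop : Continuous fun x : Fin n → ℝ => (s, x))
        ).aestronglyMeasurable (ae_of_all _ fun x => ?_)
    rw [Real.norm_of_nonneg (sampleDist_nonneg s x)]
    exact sampleDist_le s x 0
  have hcont : Continuous fun s => ∫ x, sampleDist s x ^ 2 ∂(sampleLaw f n) := by
    rw [continuous_iff_continuousAt]
    intro s
    refine continuousAt_of_dominated (bound := fun x => 2 * x 0 ^ 2 + 2 * (|s| + 1) ^ 2)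
      (Filter.Eventually.of_forall fun t => (hsel t).integrable_sq.aestronglyMeasurable) ?_ ?_ ?_
    · filter_upwards [Metric.ball_mem_nhds s one_pos] with t ht
      refine ae_of_all _ fun x => ?_
      rw [Metric.mem_ball, Real.dist_eq] at ht
      rw [Real.norm_of_nonneg (sq_nonneg _)]
      have h1 := sampleDist_le t x 0
      have h0 := sampleDist_nonneg t x
      have h2 : |t| ≤ |s| + 1 := by
        have := abs_add_le s (t - s); rw [add_sub_cancel] at this; linarith
      have h3 : sampleDist t x ≤ |x 0| + (|s| + 1) := by
        linarith [abs_sub (x 0) t]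
      rw [← sq_abs (x 0)]
      nlinarith [sq_nonneg (|x 0| - (|s| + 1))]
    · exact (hL.integrable_sq.const_mul 2).add (integrable_const _)
    · refine ae_of_all _ fun x => ?_
      exact ((continuous_sampleDist.comp (by fun_prop : Continuous fun t : ℝ => (t, x))).pow 2
        ).continuousAt
  -- Quadratic growth, from `s ^ 2 ≤ 2 (xᵢ - s) ^ 2 + 2 xᵢ ^ 2` at a nearest sample point; it
  -- dominates the linear tilt.
  have hlow : ∀ s : ℝ, s ^ 2 / 2 - ∫ x, ∑ i, x i ^ 2 ∂(sampleLaw f n) ≤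
      ∫ x, sampleDist s x ^ 2 ∂(sampleLaw f n) := fun s => by
    have hS : Integrable (fun x : Fin n → ℝ => ∑ i, x i ^ 2) (sampleLaw f n) :=
      integrable_finsetSum _ fun i _ => (hf.memLp_eval i).integrable_sq
    have : s ^ 2 / 2 - ∫ x, ∑ i, x i ^ 2 ∂(sampleLaw f n) =
        ∫ x, (s ^ 2 / 2 - ∑ i, x i ^ 2) ∂(sampleLaw f n) := by
      rw [integral_sub (integrable_const _) hS]; simp
    rw [this]
    refine integral_mono ((integrable_const _).sub hS) (hsel s).integrable_sq fun x => ?_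
    obtain ⟨i, hi⟩ := exists_sampleDist_eq s x
    have := Finset.single_le_sum (f := fun i => x i ^ 2) (fun j _ => sq_nonneg _)
      (Finset.mem_univ i)
    simp only [hi, sq_abs] at this ⊢
    nlinarith [sq_nonneg (2 * x i - s)]
  refine Continuous.exists_forall_le' (hcont.sub (by fun_prop)) 0 ?_
  set A := ∫ x, ∑ i, x i ^ 2 ∂(sampleLaw f n)
  set m0 := ∫ x, sampleDist 0 x ^ 2 ∂(sampleLaw f n)
  -- Beyond this threshold `s ^ 2 / 2 - 2 |Δ| |s| ≥ |s| (1 + |m0 + A|) ≥ m0 + A`, so the objective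
  -- is at least its value `m0` at `0`.
  have hco : ∀ᶠ s : ℝ in Filter.cocompact ℝ, 4 * |Δ| + 2 + 2 * |m0 + A| ≤ ‖s‖ :=
    tendsto_norm_cocompact_atTop.eventually_ge_atTop _
  filter_upwards [hco] with s hs
  have := hlow s
  rw [Real.norm_eq_abs] at hs
  have h1 : 2 * Δ * s ≤ 2 * |Δ| * |s| := by
    rw [mul_assoc, mul_assoc, ← abs_mul]; linarith [le_abs_self (Δ * s)]
  have h2 := le_abs_self (m0 + A)
  have h3 := abs_nonneg (m0 + A)
  have h4 := abs_nonneg Δ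
  rw [← sq_abs s] at this
  nlinarith [mul_nonneg h3 (abs_nonneg s)]

/-- Translation-invariant equilibria exist under foresight. -/
theorem exists_isTranslationInvariantPBE {f : ℝ → ℝ} (hf : IsNoiseDensity f) {n : ℕ} (hn : n ≠ 0)
    (MS MR : ℝ) : ∃ (π : (Fin n → ℝ) → ℝ → ℝ) (α : ℝ → ℝ),
      IsTranslationInvariantPBE f foresight MS MR π α := by
  have := hf.isProbabilityMeasure
  have : NeZero n := ⟨hn⟩
  obtain ⟨r, hr⟩ := exists_minimiser_sampleDist hf (n := n) (MS - MR)
  have hsel := isNearestSelection_nearestScheme (n := n) r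
  set C : (Fin n → ℝ) → ℝ := fun x => nearestScheme r x 0 with hC
  have hCL := hf.memLp_of_selects hsel.measurable hsel.selects
  set m := ∫ x, C x ∂(sampleLaw f n) with hm
  have hrm : r - m = MS - MR := by
    -- An envelope argument replaces differentiation. With `C` fixed, `E (C - s) ^ 2` dominates the
    -- expected squared distance to `s`, with equality at `s = r`, so `r` also minimises the tilted
    -- parabola.
    have key : ∀ s, (r - m) ^ 2 - 2 * (MS - MR) * r ≤ (m - s) ^ 2 - 2 * (MS - MR) * s := by
      intro s
      have h1 := hr s
      have h2 : ∫ x, sampleDist s x ^ 2 ∂(sampleLaw f n) ≤ ∫ x, (C x - s) ^ 2 ∂(sampleLaw f n) := by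
        refine integral_mono_of_nonneg (ae_of_all _ fun x => sq_nonneg _)
          (hCL.sub (memLp_const s)).integrable_sq (ae_of_all _ fun x => ?_)
        obtain ⟨i, hi⟩ := hsel.selects x
        simp only
        rw [hi, ← sq_abs (x i - s)]
        have := sampleDist_le s x i
        have := sampleDist_nonneg s x
        gcongr
      have h3 : ∫ x, sampleDist r x ^ 2 ∂(sampleLaw f n) = ∫ x, (C x - r) ^ 2 ∂(sampleLaw f n) := by
        congr 1; ext x; exact (hsel.sq_eq x).symm
      have h4 := integral_sub_sq_eq hCL s
      have h5 := integral_sub_sq_eq hCL r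
      rw [← hm] at h4 h5
      nlinarith
    -- This is the vertex of the parabola; comparing there gives `(r - m - (MS - MR)) ^ 2 ≤ 0`.
    have h1 := key (m + (MS - MR))
    nlinarith [sq_nonneg (r - m - (MS - MR))]
  set Q := (sampleLaw f n).map C with hQdef
  have hQ : IsProbabilityMeasure Q := Measure.isProbabilityMeasure_map hsel.measurable.aemeasurable
  refine ⟨nearestScheme r, fun z => z + (MR - m), ⟨shiftKernel Q, isScheme_nearestScheme r,
    fun z => ?_, ⟨inferInstance, fun A D hA hD => ?_⟩, fun x y => ?_⟩, nearestScheme_add r,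
    fun x δ => by ring⟩
  · obtain ⟨hL, hmean⟩ := memLp_shiftKernel hf hsel.measurable hsel.selects z
    rw [isBestAction_univ_iff hL, hmean]
    ring
  · rw [jointLaw_foresight (isScheme_nearestScheme r) (nearestScheme_add r), shiftJoint_snd,
      shiftJoint_prod _ hA hD]
  · exact (sender_best_iff hf.pos (by linarith) (nearestScheme_selects r) x y).2
      (nearestScheme_nearest r x y)

/-! ### Reflection -/

lemma measurePreserving_neg_lawOfDensity {f : ℝ → ℝ} (hm : Measurable f)
    (he : ∀ x, f (-x) = f x) :
    MeasurePreserving (fun x : ℝ => -x) (lawOfDensity f) (lawOfDensity f) := by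
  refine ⟨measurable_neg, Measure.ext fun S hS => ?_⟩
  rw [Measure.map_apply measurable_neg hS, lawOfDensity,
    withDensity_apply _ (measurable_neg hS), withDensity_apply _ hS,
    ← (Measure.measurePreserving_neg (volume : Measure ℝ)).setLIntegral_comp_preimage hS
      hm.ennreal_ofReal]
  simp only [he]

/-- Negating the sample preserves its law when the density is even. Variance bounds therefore need
proof only for `r ≥ 0`. -/
lemma IsNearestSelection.exists_reflection {f : ℝ → ℝ} (hf : IsNoiseDensity f)
    (he : ∀ x, f (-x) = f x) {n : ℕ} {r : ℝ} {C : (Fin n → ℝ) → ℝ} (hC : IsNearestSelection r C) :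
    ∃ C' : (Fin n → ℝ) → ℝ, IsNearestSelection (-r) C' ∧
      ∫ x, C' x ∂(sampleLaw f n) = -∫ x, C x ∂(sampleLaw f n) ∧
      ∫ x, (C' x - ∫ x', C' x' ∂(sampleLaw f n)) ^ 2 ∂(sampleLaw f n) =
        ∫ x, (C x - ∫ x', C x' ∂(sampleLaw f n)) ^ 2 ∂(sampleLaw f n) := by
  have := hf.isProbabilityMeasure
  have hpres : MeasurePreserving (fun (x : Fin n → ℝ) i => -x i) (sampleLaw f n) (sampleLaw f n) :=
    measurePreserving_pi _ _ fun _ => measurePreserving_neg_lawOfDensity hf.measurable he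
  have hint : ∀ {φ : (Fin n → ℝ) → ℝ}, Measurable φ →
      ∫ x, φ (fun i => -x i) ∂(sampleLaw f n) = ∫ x, φ x ∂(sampleLaw f n) := fun {φ} hφ => by
    conv_rhs => rw [← hpres.map_eq,
      integral_map hpres.measurable.aemeasurable hφ.aestronglyMeasurable]
  have hmean : ∫ x, -C (fun i => -x i) ∂(sampleLaw f n) = -∫ x, C x ∂(sampleLaw f n) := by
    rw [integral_neg, hint hC.measurable]
  refine ⟨fun x => -C fun i => -x i, ⟨(hC.measurable.comp hpres.measurable).neg, fun x => ?_,
    fun x i => ?_⟩, hmean, ?_⟩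
  · obtain ⟨i, hi⟩ := hC.selects fun i => -x i
    exact ⟨i, by rw [hi, neg_neg]⟩
  · have := hC.nearest (fun i => -x i) i
    have h1 : ∀ a : ℝ, |-a - -r| = |a - r| := fun a => by rw [← abs_neg]; congr 1; ring
    have h2 : |x i - -r| = |-x i - r| := by rw [← abs_neg]; congr 1; ring
    rwa [h1, h2]
  · rw [hmean, ← hint (hC.measurable.sub_const _ |>.pow_const 2)]
    congr 1; ext x; ring

/-! ### A lower bound for the distance of a sample to a point -/

/-- The ball of radius `1 / (4 M)` about `r` has mass at most `1 / 2`, so all `n` samples miss it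
with probability at least `(1 / 2) ^ n`; Markov's inequality concludes. -/
lemma IsNearestSelection.le_integral_sq {f : ℝ → ℝ} (hf : IsNoiseDensity f) {M : ℝ}
    (hM : ∀ x, f x ≤ M) {n : ℕ} {r : ℝ} {C : (Fin n → ℝ) → ℝ} (hC : IsNearestSelection r C) :
    (1 / (4 * M)) ^ 2 * (1 / 2) ^ n ≤ ∫ x, (C x - r) ^ 2 ∂(sampleLaw f n) := by
  have := hf.isProbabilityMeasure
  have hM0 : 0 < M := (hf.pos 0).trans_le (hM 0)
  set s := 1 / (4 * M) with hs
  have hs0 : 0 < s := by positivity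
  have hmarkov := mul_meas_ge_le_integral_of_nonneg (μ := sampleLaw f n)
    (f := fun x => (C x - r) ^ 2) (ae_of_all _ fun x => sq_nonneg _)
    ((hf.memLp_of_selects hC.measurable hC.selects).sub (memLp_const r)).integrable_sq (s ^ 2)
  refine le_trans (mul_le_mul_of_nonneg_left ?_ (sq_nonneg s)) hmarkov
  have hball : lawOfDensity f {x | s ≤ |x - r|} ≥ ENNReal.ofReal (1 / 2) := by
    have hms : MeasurableSet (Metric.ball r s) := measurableSet_ball
    have hcompl : {x | s ≤ |x - r|} = (Metric.ball r s)ᶜ := by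
      ext x; simp [Metric.mem_ball, Real.dist_eq]
    have hle : lawOfDensity f (Metric.ball r s) ≤ ENNReal.ofReal (1 / 2) := by
      rw [lawOfDensity, withDensity_apply _ hms]
      calc ∫⁻ x in Metric.ball r s, ENNReal.ofReal (f x)
          ≤ ∫⁻ _ in Metric.ball r s, ENNReal.ofReal M :=
            lintegral_mono fun x => ENNReal.ofReal_le_ofReal (hM x)
        _ = ENNReal.ofReal (1 / 2) := by
            rw [setLIntegral_const, Real.volume_ball, ← ENNReal.ofReal_mul hM0.le, hs]
            congr 1; field_simp; norm_num
    rw [hcompl, prob_compl_eq_one_sub hms, ge_iff_le]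
    refine le_trans (le_of_eq ?_) (tsub_le_tsub_left hle 1)
    rw [← ENNReal.ofReal_one, ← ENNReal.ofReal_sub _ (by norm_num)]
    norm_num
  have hsub : Set.univ.pi (fun _ : Fin n => {x : ℝ | s ≤ |x - r|}) ⊆
      {x | s ^ 2 ≤ (C x - r) ^ 2} := fun x hx => by
    obtain ⟨i, hi⟩ := hC.selects x
    have := hx i trivial
    simp only [Set.mem_ofPred_eq] at this ⊢
    rw [hi, ← sq_abs (x i - r)]
    gcongr
  have hpow : ENNReal.ofReal ((1 / 2) ^ n) ≤ sampleLaw f n {x | s ^ 2 ≤ (C x - r) ^ 2} := by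
    refine le_trans ?_ (measure_mono hsub)
    rw [Measure.pi_pi, ENNReal.ofReal_pow (by norm_num), Finset.prod_const, Finset.card_univ,
      Fintype.card_fin]
    gcongr
  exact (ENNReal.ofReal_le_iff_le_toReal (measure_ne_top _ _)).1 hpow

/-! ### An upper bound for the variance of a nearest-sample selection -/

/-- Layer-cake formula with weight `2 s`: the second moment is dominated by that of an exponential
variable of rate `k`. -/
lemma lintegral_sq_le_of_tail {Ω : Type*} [MeasurableSpace Ω] {μ : Measure Ω} {h : Ω → ℝ}
    (h0 : ∀ ω, 0 ≤ h ω) (hm : Measurable h) {k : ℝ} (hk : 0 < k)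
    (ht : ∀ s, 0 < s → μ {ω | s < h ω} ≤ ENNReal.ofReal (Real.exp (-(k * s)))) :
    ∫⁻ ω, ENNReal.ofReal (h ω ^ 2) ∂μ ≤ ENNReal.ofReal (2 / k ^ 2) := by
  have hcake := lintegral_comp_eq_lintegral_meas_lt_mul (g := fun s => 2 * s) μ
    (ae_of_all _ h0) hm.aemeasurable
    (fun t _ => (by fun_prop : Continuous fun s : ℝ => 2 * s).intervalIntegrable _ _)
    (by filter_upwards [ae_restrict_mem measurableSet_Ioi] with s hs
        have : (0 : ℝ) < s := hs
        positivity)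
  have hint : ∀ a : ℝ, ∫ s in (0 : ℝ)..a, 2 * s = a ^ 2 := fun a => by
    rw [intervalIntegral.integral_const_mul, integral_id]; ring
  simp only [hint] at hcake
  rw [hcake]
  have hG : ∫ s in Set.Ioi (0 : ℝ), Real.exp (-(k * s)) * (2 * s) = 2 / k ^ 2 := by
    have := Real.integral_rpow_mul_exp_neg_mul_Ioi (a := 2) (r := k) (by norm_num) hk
    have hg : Real.Gamma 2 = 1 := by simp
    rw [hg] at this
    calc ∫ s in Set.Ioi (0 : ℝ), Real.exp (-(k * s)) * (2 * s)
        = ∫ s in Set.Ioi (0 : ℝ), 2 * (s ^ ((2 : ℝ) - 1) * Real.exp (-(k * s))) := by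
          congr 1; ext s; norm_num; ring
      _ = 2 / k ^ 2 := by
          rw [integral_const_mul, this]; norm_num; field_simp
  have hI : Integrable (fun s => Real.exp (-(k * s)) * (2 * s))
      (volume.restrict (Set.Ioi (0 : ℝ))) := by
    -- A non-integrable function has Bochner integral `0` by convention, which the positive value in
    -- `hG` excludes.
    by_contra hcon
    rw [integral_undef hcon] at hG
    have : 0 < 2 / k ^ 2 := by positivity
    linarith
  rw [← hG, ofReal_integral_eq_lintegral_ofReal hI]
  · refine setLIntegral_mono (by fun_prop) fun s hs => ?_
    have hs' : (0 : ℝ) < s := hs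
    rw [ENNReal.ofReal_mul (Real.exp_pos _).le]
    gcongr
    exact ht s hs'
  · filter_upwards [ae_restrict_mem measurableSet_Ioi] with s hs
    have : (0 : ℝ) < s := hs
    positivity

/-- Each sample hits the interval with probability at least `K (b - a) / n`. By `1 - p ≤ exp (-p)`,
the `n`-th power of the miss probability loses its dependence on `n`. -/
lemma sampleLaw_forall_notMem_Icc_le {f : ℝ → ℝ} (hf : IsNoiseDensity f) {n : ℕ} (hn : n ≠ 0)
    {K a b : ℝ} (hK : 0 ≤ K) (hab : a ≤ b) (hlow : ∀ x ∈ Set.Icc a b, K / n ≤ f x) :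
    sampleLaw f n {x | ∀ i, x i ∉ Set.Icc a b} ≤ ENNReal.ofReal (Real.exp (-(K * (b - a)))) := by
  have := hf.isProbabilityMeasure
  have hset : {x : Fin n → ℝ | ∀ i, x i ∉ Set.Icc a b} = Set.univ.pi fun _ => (Set.Icc a b)ᶜ := by
    ext x; simp
  have hn' : (0 : ℝ) < n := by positivity
  have hI : ENNReal.ofReal (K / n * (b - a)) ≤ lawOfDensity f (Set.Icc a b) := by
    rw [lawOfDensity, withDensity_apply _ measurableSet_Icc]
    calc ENNReal.ofReal (K / n * (b - a)) = ∫⁻ _ in Set.Icc a b, ENNReal.ofReal (K / n) := by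
          rw [setLIntegral_const, Real.volume_Icc, ENNReal.ofReal_mul (by positivity)]
      _ ≤ _ := setLIntegral_mono (by have := hf.measurable; fun_prop) fun x hx =>
          ENNReal.ofReal_le_ofReal (hlow x hx)
  have hc : lawOfDensity f (Set.Icc a b)ᶜ ≤ ENNReal.ofReal (Real.exp (-(K / n * (b - a)))) := by
    rw [prob_compl_eq_one_sub measurableSet_Icc]
    refine (tsub_le_tsub_left hI 1).trans ?_
    rw [← ENNReal.ofReal_one, ← ENNReal.ofReal_sub _ (by
      have := sub_nonneg.2 hab; positivity)]
    exact ENNReal.ofReal_le_ofReal (Real.one_sub_le_exp_neg _)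
  rw [hset, Measure.pi_pi, Finset.prod_const, Finset.card_univ, Fintype.card_fin]
  calc _ ≤ ENNReal.ofReal (Real.exp (-(K / n * (b - a)))) ^ n := by gcongr
    _ = _ := by
      rw [← ENNReal.ofReal_pow (Real.exp_pos _).le, ← Real.exp_nat_mul]
      congr 2; field_simp

/-- If the density is at least `K / n` on `[-t, t]`, then a sample of size `n` nearest to `r ≥ 0` is
concentrated about `min r t`. -/
lemma IsNearestSelection.integral_sub_min_sq_le {f : ℝ → ℝ} (hf : IsNoiseDensity f)
    (h4 : MemLp id 4 (lawOfDensity f)) {n : ℕ} [NeZero n] {r t K : ℝ} (hr : 0 ≤ r) (ht : 0 < t)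
    (hK : 0 < K) (hlow : ∀ x ∈ Set.Icc (-t) t, K / n ≤ f x)
    {C : (Fin n → ℝ) → ℝ} (hC : IsNearestSelection r C) :
    ∫ x, (C x - min r t) ^ 2 ∂(sampleLaw f n) ≤
      8 / K ^ 2 + 4 / t ^ 2 * ∫ x, x ^ 4 ∂(lawOfDensity f) +
        n * ∫ x, max (x - t) 0 ^ 2 ∂(lawOfDensity f) := by
  have := hf.isProbabilityMeasure
  set c := min r t with hc
  have hc0 : 0 ≤ c := le_min hr ht.le
  have hct : c ≤ t := min_le_right _ _
  -- Distance to the target when `r ≤ t`, and otherwise only the shortfall below `t`; overshoot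
  -- beyond `t` is charged to the sum of excesses.
  set g : (Fin n → ℝ) → ℝ := fun x => if r ≤ t then |C x - r| else max (t - C x) 0 with hg
  have hgm : Measurable g := by
    have := hC.measurable
    by_cases h : r ≤ t
    · simp only [hg, h, if_true]; fun_prop
    · simp only [hg, h, if_false]; fun_prop
  have hg0 : ∀ x, 0 ≤ g x := fun x => by
    simp only [hg]; split_ifs
    · exact abs_nonneg _
    · exact le_max_right _ _
  -- The exponential tail holds only while `[c - s / 2, c]` stays inside `[-t, t]`, which `s < 2 t`
  -- guarantees. Larger values of `g` force `|x 0| ≥ g / 2 > t`, so the fourth moment of one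
  -- coordinate pays for them.
  set h : (Fin n → ℝ) → ℝ := fun x => min (g x) (2 * t) with hh
  have hh0 : ∀ x, 0 ≤ h x := fun x => le_min (hg0 x) (by positivity)
  have hhm : Measurable h := hgm.min measurable_const
  have hbig : ∀ x, 2 * t < g x → g x / 2 ≤ |x 0| := fun x hx => by
    have h1 := hC.nearest x 0
    simp only [hg] at hx ⊢
    split_ifs at hx ⊢ with hrt
    · have := abs_sub (x 0) r
      rw [abs_of_nonneg hr] at this
      linarith
    · rw [lt_max_iff] at hx
      rcases hx with hx | hx
      · rw [max_eq_left (by linarith)]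
        rw [abs_of_neg (by linarith : C x - r < 0)] at h1
        rcases le_abs.1 h1 with h2 | h2
        · have := le_abs_self (x 0); linarith
        · have := neg_le_abs (x 0); linarith
      · linarith
  have hpt : ∀ x, (C x - c) ^ 2 ≤ h x ^ 2 + 4 / t ^ 2 * x 0 ^ 4 + ∑ i, max (x i - t) 0 ^ 2 := by
    intro x
    have hgx : g x ^ 2 ≤ h x ^ 2 + 4 / t ^ 2 * x 0 ^ 4 := by
      rcases le_or_gt (g x) (2 * t) with hle | hlt
      · have : h x = g x := min_eq_left hle
        rw [this]
        have : 0 ≤ 4 / t ^ 2 * x 0 ^ 4 := by positivity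
        linarith
      · have h2 := hbig x hlt
        have h3 : t ^ 2 ≤ x 0 ^ 2 := by
          rw [← sq_abs (x 0)]; gcongr; linarith
        have h5 : g x ^ 2 ≤ 4 * x 0 ^ 2 := by
          rw [← sq_abs (x 0)]; nlinarith [hg0 x]
        have h6 : 4 * x 0 ^ 2 ≤ 4 / t ^ 2 * x 0 ^ 4 := by
          rw [div_mul_eq_mul_div, le_div_iff₀ (by positivity)]
          nlinarith [sq_nonneg (x 0)]
        nlinarith [sq_nonneg (h x)]
    have hsum : 0 ≤ ∑ i, max (x i - t) 0 ^ 2 := Finset.sum_nonneg fun i _ => sq_nonneg _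
    by_cases hrt : r ≤ t
    · have : (C x - c) ^ 2 = g x ^ 2 := by
        simp only [hg, hrt, if_true, sq_abs, hc, min_eq_left hrt]
      linarith
    · have hct' : c = t := min_eq_right (not_le.1 hrt).le
      have hgx' : g x = max (t - C x) 0 := by simp only [hg, hrt, if_false]
      rw [hct']
      rcases le_total (C x) t with hle | hle
      · rw [hgx', max_eq_left (by linarith)] at hgx
        nlinarith
      · obtain ⟨i, hi⟩ := hC.selects x
        have h1 : max (x i - t) 0 ^ 2 ≤ ∑ i, max (x i - t) 0 ^ 2 :=
          Finset.single_le_sum (f := fun i => max (x i - t) 0 ^ 2) (fun j _ => sq_nonneg _)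
            (Finset.mem_univ i)
        rw [← hi, max_eq_left (by linarith)] at h1
        nlinarith [sq_nonneg (g x)]
  have htail : ∀ s, 0 < s → sampleLaw f n {x | s < h x} ≤
      ENNReal.ofReal (Real.exp (-(K / 2 * s))) := by
    intro s hs
    by_cases hst : 2 * t ≤ s
    · have : {x | s < h x} = ∅ := by
        ext x
        simp only [Set.mem_ofPred_eq, Set.mem_empty_iff_false, iff_false, not_lt]
        exact (min_le_right _ _).trans hst
      rw [this]; simp
    · push Not at hst
      -- A sample point in this interval would bring `C` within `s / 2` of `r`, or make its
      -- shortfall below `t` at most `s / 2`. The length `s / 2` is the source of the rate `K / 2`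
      -- and the constant `8 / K ^ 2`.
      have hsub : {x | s < h x} ⊆ {x : Fin n → ℝ | ∀ i, x i ∉ Set.Icc (c - s / 2) c} := by
        intro x hx i hi
        have hx' : s < g x := lt_of_lt_of_le hx (min_le_left _ _)
        have h1 := hC.nearest x i
        obtain ⟨hi1, hi2⟩ := hi
        simp only [hg] at hx'
        split_ifs at hx' with hrt
        · rw [hc, min_eq_left hrt] at hi1 hi2
          rw [abs_of_nonpos (by linarith : x i - r ≤ 0)] at h1
          linarith
        · rw [hc, min_eq_right (not_le.1 hrt).le] at hi1 hi2
          push Not at hrt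
          rw [abs_of_nonpos (by linarith : x i - r ≤ 0)] at h1
          have h2 := neg_abs_le (C x - r)
          rcases lt_max_iff.1 hx' with h3 | h3 <;> linarith
      refine (measure_mono hsub).trans ((sampleLaw_forall_notMem_Icc_le hf (NeZero.ne n) hK.le
        (by linarith) fun x hx => hlow x ⟨by linarith [hx.1], by linarith [hx.2]⟩).trans ?_)
      apply le_of_eq; congr 3; ring
  have hCL := hf.memLp_of_selects hC.measurable hC.selects
  have hhI : Integrable (fun x => h x ^ 2) (sampleLaw f n) := by
    have : MemLp h 2 (sampleLaw f n) := (memLp_const (2 * t)).mono hhm.aestronglyMeasurable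
      (ae_of_all _ fun x => by
        rw [Real.norm_of_nonneg (hh0 x)]; exact (min_le_right _ _).trans (le_abs_self _))
    exact this.integrable_sq
  have hh2 : ∫ x, h x ^ 2 ∂(sampleLaw f n) ≤ 8 / K ^ 2 := by
    rw [integral_eq_lintegral_of_nonneg_ae (ae_of_all _ fun x => sq_nonneg _)
      hhI.aestronglyMeasurable]
    refine ENNReal.toReal_le_of_le_ofReal (by positivity)
      ((lintegral_sq_le_of_tail hh0 hhm (by positivity) htail).trans (le_of_eq ?_))
    congr 1; field_simp; norm_num
  have h4I : Integrable (fun x : ℝ => x ^ 4) (lawOfDensity f) := by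
    have := h4.integrable_norm_pow (p := 4) (by norm_num)
    simpa [Even.pow_abs (by decide : Even 4)] using this
  have hmI : Integrable (fun x : ℝ => max (x - t) 0 ^ 2) (lawOfDensity f) := by
    have : MemLp (fun x : ℝ => max (x - t) 0) 2 (lawOfDensity f) :=
      (hf.memLp.sub (memLp_const t)).mono (by fun_prop) (ae_of_all _ fun x => by
        rw [Real.norm_of_nonneg (le_max_right _ _)]
        exact max_le (le_abs_self _) (abs_nonneg _))
    exact this.integrable_sq
  have hev : ∀ i : Fin n, MeasurePreserving (Function.eval i) (sampleLaw f n) (lawOfDensity f) :=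
    fun i => measurePreserving_eval (fun _ => lawOfDensity f) i
  have hi4 : Integrable (fun x : Fin n → ℝ => 4 / t ^ 2 * x 0 ^ 4) (sampleLaw f n) :=
    ((hev 0).integrable_comp_of_integrable h4I).const_mul _
  have him : ∀ i : Fin n, Integrable (fun x : Fin n → ℝ => max (x i - t) 0 ^ 2) (sampleLaw f n) :=
    fun i => (hev i).integrable_comp_of_integrable hmI
  have hcomp : ∀ (i : Fin n) (φ : ℝ → ℝ), Measurable φ →
      ∫ x, φ (x i) ∂(sampleLaw f n) = ∫ x, φ x ∂(lawOfDensity f) := fun i φ hφ => by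
    rw [← (hev i).map_eq, integral_map (hev i).measurable.aemeasurable hφ.aestronglyMeasurable]
  have hadd : Integrable (fun x : Fin n → ℝ => h x ^ 2 + 4 / t ^ 2 * x 0 ^ 4) (sampleLaw f n) :=
    hhI.add hi4
  calc ∫ x, (C x - c) ^ 2 ∂(sampleLaw f n)
      ≤ ∫ x, (h x ^ 2 + 4 / t ^ 2 * x 0 ^ 4 + ∑ i, max (x i - t) 0 ^ 2) ∂(sampleLaw f n) :=
        integral_mono (hCL.sub (memLp_const c)).integrable_sq
          (hadd.add (integrable_finsetSum _ fun i _ => him i)) hpt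
    _ = ∫ x, h x ^ 2 ∂(sampleLaw f n) + 4 / t ^ 2 * ∫ x, x ^ 4 ∂(lawOfDensity f) +
        n * ∫ x, max (x - t) 0 ^ 2 ∂(lawOfDensity f) := by
        rw [integral_add hadd (integrable_finsetSum _ fun i _ => him i),
          integral_add hhI hi4, integral_finsetSum _ fun i _ => him i, integral_const_mul,
          hcomp 0 (fun x => x ^ 4) (by fun_prop)]
        congr 1
        rw [Finset.sum_congr rfl fun i _ =>
          hcomp i (fun x => max (x - t) 0 ^ 2) (by fun_prop)]
        simp
    _ ≤ _ := by gcongr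

/-! ### Gaussian noise -/

lemma lawOfDensity_gaussianPDFReal {v : ℝ≥0} (hv : v ≠ 0) :
    lawOfDensity (gaussianPDFReal 0 v) = gaussianReal 0 v := by
  rw [gaussianReal_of_var_ne_zero 0 hv]; rfl

lemma isNoiseDensity_gaussianPDFReal {v : ℝ≥0} (hv : v ≠ 0) :
    IsNoiseDensity (gaussianPDFReal 0 v) where
  measurable := measurable_gaussianPDFReal 0 v
  pos x := gaussianPDFReal_pos 0 v x hv
  isProbabilityMeasure := by rw [lawOfDensity_gaussianPDFReal hv]; infer_instance
  memLp := by rw [lawOfDensity_gaussianPDFReal hv]; exact memLp_id_gaussianReal 2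

lemma gaussianPDFReal_zero_mean (v : ℝ≥0) (x : ℝ) :
    gaussianPDFReal 0 v x = (√(2 * Real.pi * v))⁻¹ * Real.exp (-x ^ 2 / (2 * v)) := by
  simp [gaussianPDFReal]

lemma gaussianPDFReal_le_of_abs_le (v : ℝ≥0) {x y : ℝ} (h : |x| ≤ |y|) :
    gaussianPDFReal 0 v y ≤ gaussianPDFReal 0 v x := by
  rw [gaussianPDFReal_zero_mean, gaussianPDFReal_zero_mean]
  have := sq_le_sq.2 h
  gcongr

lemma integrableOn_sq_mul_exp_neg_mul_Ioi {k : ℝ} (hk : 0 < k) :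
    IntegrableOn (fun s => s ^ 2 * Real.exp (-(k * s))) (Set.Ioi 0) ∧
      ∫ s in Set.Ioi (0 : ℝ), s ^ 2 * Real.exp (-(k * s)) = 2 / k ^ 3 := by
  have hI : ∫ s in Set.Ioi (0 : ℝ), s ^ 2 * Real.exp (-(k * s)) = 2 / k ^ 3 := by
    have := Real.integral_rpow_mul_exp_neg_mul_Ioi (a := 3) (r := k) (by norm_num) hk
    have hg : Real.Gamma 3 = 2 := by
      simp
    rw [hg] at this
    norm_num at this
    rw [this]; field_simp
  refine ⟨?_, hI⟩
  by_contra hcon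
  rw [integral_undef hcon] at hI
  have : 0 < 2 / k ^ 3 := by positivity
  linarith

/-- After the shift `x = t + s`, completing the square bounds the density by its value at `t` times
`exp (-(t / v) s)`; the remaining integral is a Gamma integral. -/
lemma integral_max_sub_sq_gaussianReal_le {v : ℝ≥0} (hv : v ≠ 0) {t : ℝ} (ht : 0 < t) :
    ∫ x, max (x - t) 0 ^ 2 ∂(gaussianReal 0 v) ≤ gaussianPDFReal 0 v t * (2 * (v / t) ^ 3) := by
  have hv0 : (0 : ℝ) < v := by exact_mod_cast pos_iff_ne_zero.2 hv
  obtain ⟨hI, hval⟩ := integrableOn_sq_mul_exp_neg_mul_Ioi (k := t / v) (by positivity)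
  rw [integral_gaussianReal_eq_integral_smul hv,
    ← integral_add_right_eq_self _ t]
  have hrhs : gaussianPDFReal 0 v t * (2 * (v / t) ^ 3) =
      ∫ s, (Set.Ioi (0 : ℝ)).indicator
        (fun s => gaussianPDFReal 0 v t * (s ^ 2 * Real.exp (-(t / v * s)))) s := by
    rw [integral_indicator measurableSet_Ioi, integral_const_mul, hval]
    congr 1; field_simp
  rw [hrhs]
  refine integral_mono_of_nonneg (ae_of_all _ fun s => ?_)
    ((integrable_indicator_iff measurableSet_Ioi).2 (hI.const_mul _)) (ae_of_all _ fun s => ?_)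
  · exact smul_nonneg (gaussianPDFReal_nonneg 0 v _) (sq_nonneg _)
  · simp only [add_sub_cancel_right, smul_eq_mul]
    by_cases hs : 0 < s
    · rw [Set.indicator_of_mem (Set.mem_Ioi.2 hs), max_eq_left hs.le, mul_comm (s ^ 2), ← mul_assoc]
      gcongr
      rw [gaussianPDFReal_zero_mean, gaussianPDFReal_zero_mean, mul_assoc (√(2 * Real.pi * v))⁻¹,
        ← Real.exp_add]
      gcongr
      have : -t ^ 2 / (2 * v) + -(t / v * s) = (-t ^ 2 - 2 * t * s) / (2 * v) := by
        field_simp; ring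
      rw [this]
      gcongr
      nlinarith [sq_nonneg s]
    · rw [Set.indicator_of_notMem (by simpa using hs), max_eq_right (not_lt.1 hs)]
      simp

/-- At the level `t` the sample has intensity `K` per unit length. Inverting the density gives `t ^
2 = 2 v log (n / (K A))`, which exceeds any `T ^ 2` for large `n`. -/
lemma exists_gaussianPDFReal_eq {v : ℝ≥0} (hv : v ≠ 0) {T K : ℝ} (hK : 0 < K) :
    ∃ N : ℕ, ∀ n : ℕ, N < n → ∃ t, T ≤ t ∧ gaussianPDFReal 0 v t = K / n := by
  have hv0 : (0 : ℝ) < v := by exact_mod_cast pos_iff_ne_zero.2 hv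
  set A := √(2 * Real.pi * v) with hA
  have hA0 : 0 < A := by positivity
  obtain ⟨N, hN⟩ := exists_nat_ge (K * A * Real.exp (T ^ 2 / (2 * v)))
  refine ⟨N, fun n hn => ?_⟩
  have hnN : K * A * Real.exp (T ^ 2 / (2 * v)) ≤ n := hN.trans (by exact_mod_cast hn.le)
  have hn0 : (0 : ℝ) < n := lt_of_lt_of_le (by positivity) hnN
  have hlog : T ^ 2 / (2 * v) ≤ Real.log (n / (K * A)) := by
    rw [Real.le_log_iff_exp_le (by positivity), le_div_iff₀ (by positivity)]
    linarith
  have hlog' : T ^ 2 ≤ 2 * v * Real.log (n / (K * A)) := by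
    rw [div_le_iff₀ (by positivity)] at hlog; linarith
  refine ⟨√(2 * v * Real.log (n / (K * A))), Real.le_sqrt_of_sq_le hlog', ?_⟩
  rw [gaussianPDFReal_zero_mean, Real.sq_sqrt ((sq_nonneg T).trans hlog')]
  have : -(2 * v * Real.log (n / (K * A))) / (2 * v) = -Real.log (n / (K * A)) := by
    field_simp
  rw [this, Real.exp_neg, Real.exp_log (by positivity), ← hA]
  field_simp

/-- With Gaussian noise, the variance of nearest-sample selections is small for large samples,
uniformly in the target. -/
theorem exists_forall_variance_lt_gaussian {v : ℝ≥0} (hv : v ≠ 0) {L : ℝ} (hL : 0 < L) :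
    ∃ N : ℕ, ∀ n : ℕ, N < n → ∀ (r : ℝ) (C : (Fin n → ℝ) → ℝ), IsNearestSelection r C →
      ∫ x, (C x - ∫ x', C x' ∂(sampleLaw (gaussianPDFReal 0 v) n)) ^ 2
        ∂(sampleLaw (gaussianPDFReal 0 v) n) < L := by
  have hv0 : (0 : ℝ) < v := by exact_mod_cast pos_iff_ne_zero.2 hv
  set f := gaussianPDFReal 0 v with hfdef
  have hf : IsNoiseDensity f := isNoiseDensity_gaussianPDFReal hv
  have := hf.isProbabilityMeasure
  have h4 : MemLp id 4 (lawOfDensity f) := by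
    rw [lawOfDensity_gaussianPDFReal hv]; exact memLp_id_gaussianReal 4
  have he : ∀ x, f (-x) = f x := fun x => by
    simp only [hfdef, gaussianPDFReal_zero_mean, neg_sq]
  set c4 := ∫ x, x ^ 4 ∂(lawOfDensity f)
  -- The order of choice matters: `K` makes the gap term small, then `T`, depending on `K`, controls
  -- the fourth-moment and overshoot terms, and `N` pushes the level of intensity `K` beyond `T`.
  obtain ⟨K, hK0, hK⟩ : ∃ K : ℝ, 0 < K ∧ 8 / K ^ 2 < L / 2 := by
    have h : Filter.Tendsto (fun K : ℝ => 8 / K ^ 2) Filter.atTop (nhds 0) :=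
      tendsto_const_nhds.div_atTop (Filter.tendsto_pow_atTop (by norm_num))
    obtain ⟨K, h1, h2⟩ := ((Filter.eventually_gt_atTop 0).and
      (h.eventually_lt_const (half_pos hL))).exists
    exact ⟨K, h1, h2⟩
  obtain ⟨T, hT0, hT⟩ : ∃ T : ℝ, 0 < T ∧ ∀ t, T ≤ t →
      4 / t ^ 2 * c4 + K * (2 * (v / t) ^ 3) < L / 2 := by
    have h : Filter.Tendsto (fun t : ℝ => 4 / t ^ 2 * c4 + K * (2 * (v / t) ^ 3))
        Filter.atTop (nhds (0 * c4 + K * (2 * 0 ^ 3))) := by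
      refine Filter.Tendsto.add (Filter.Tendsto.mul_const _
        (tendsto_const_nhds.div_atTop (Filter.tendsto_pow_atTop (by norm_num))))
        (Filter.Tendsto.const_mul _ (Filter.Tendsto.const_mul _ (Filter.Tendsto.pow
          (tendsto_const_nhds.div_atTop Filter.tendsto_id) 3)))
    obtain ⟨T, hT⟩ := Filter.eventually_atTop.1 ((Filter.eventually_gt_atTop 0).and
      (h.eventually_lt_const (show 0 * c4 + K * (2 * 0 ^ 3) < L / 2 by simpa using hL)))
    exact ⟨T, (hT T le_rfl).1, fun t ht => (hT t ht).2⟩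
  obtain ⟨N, hN⟩ := exists_gaussianPDFReal_eq hv (T := T) hK0
  refine ⟨N, fun n hn => ?_⟩
  have : NeZero n := ⟨by omega⟩
  have hn0 : (0 : ℝ) < n := by exact_mod_cast (NeZero.pos n)
  obtain ⟨t, htT, htK⟩ := hN n hn
  have ht0 : 0 < t := hT0.trans_le htT
  have key : ∀ (r : ℝ) (C : (Fin n → ℝ) → ℝ), 0 ≤ r → IsNearestSelection r C →
      ∫ x, (C x - ∫ x', C x' ∂(sampleLaw f n)) ^ 2 ∂(sampleLaw f n) < L := by
    intro r C hr hC
    have h1 := hC.integral_sub_min_sq_le hf h4 hr ht0 hK0 fun x hx => by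
      rw [← htK]
      exact gaussianPDFReal_le_of_abs_le v ((abs_le.2 hx).trans (le_abs_self t))
    have h2 := integral_sub_sq_eq (hf.memLp_of_selects hC.measurable hC.selects) (min r t)
    have h3 : n * ∫ x, max (x - t) 0 ^ 2 ∂(lawOfDensity f) ≤ K * (2 * (v / t) ^ 3) := by
      have := integral_max_sub_sq_gaussianReal_le hv ht0
      rw [htK, ← lawOfDensity_gaussianPDFReal hv] at this
      calc n * ∫ x, max (x - t) 0 ^ 2 ∂(lawOfDensity f)
          ≤ n * (K / n * (2 * (v / t) ^ 3)) := by gcongr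
        _ = K * (2 * (v / t) ^ 3) := by field_simp
    have h5 := hT t htT
    have h6 := sq_nonneg (∫ x, C x ∂(sampleLaw f n) - min r t)
    linarith
  intro r C hC
  rcases le_total 0 r with hr | hr
  · exact key r C hr hC
  · obtain ⟨C', hC', -, hvar⟩ := hC.exists_reflection hf he
    rw [← hvar]
    exact key (-r) C' (by linarith) hC'

/-- Alignment gives `E C' = r'`, so the loss with the poorly informed sender is a mean squared
distance to the target, with a positive lower bound depending only on `n₀` and `f 0`. The expert's
loss falls below it uniformly in the target, hence in the preferences. -/
theorem exists_forall_receiverPrefers_gaussian {v : ℝ≥0} (hv : v ≠ 0) {n₀ : ℕ} (hn₀ : 1 ≤ n₀) :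
    ∃ n₁ : ℕ, ∀ n : ℕ, n₀ < n → n₁ < n → ∀ MR MS : ℝ,
      ReceiverPrefers (gaussianPDFReal 0 v) foresight MR n MS n₀ MR := by
  have hf := isNoiseDensity_gaussianPDFReal hv
  set f := gaussianPDFReal 0 v
  have hM : ∀ x, f x ≤ f 0 := fun x => gaussianPDFReal_le_of_abs_le v (by simp)
  have hM0 := hf.pos 0
  obtain ⟨N, hN⟩ := exists_forall_variance_lt_gaussian hv
    (L := (1 / (4 * f 0)) ^ 2 * (1 / 2) ^ n₀) (by positivity)
  refine ⟨N, fun n hn₀n hn MR MS => ⟨exists_isTranslationInvariantPBE hf (by omega) MS MR,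
    exists_isTranslationInvariantPBE hf (by omega) MR MR, fun π α π' α' h h' θ => ?_⟩⟩
  obtain ⟨r, C, hC, -, hu⟩ := h.exists_selection hf
  obtain ⟨r', C', hC', hr', hu'⟩ := h'.exists_selection hf
  rw [hu, hu', neg_lt_neg_iff]
  refine (hN n hn r C hC).trans_le ?_
  have h1 := hC'.le_integral_sq hf hM
  have : r' = ∫ x, C' x ∂(sampleLaw f n₀) := by linarith
  rwa [this] at h1

/-! ### The density of a nearest-sample selection -/

/-- Condition on coordinate `i`: the other `k` coordinates are independent, so the probability that
all satisfy the constraint is a `k`-th power. -/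
lemma lintegral_mul_indicator_forall_succAbove (P : Measure ℝ) [IsProbabilityMeasure P] {k : ℕ}
    (i : Fin (k + 1)) {φ : ℝ → ℝ≥0∞} (hφ : Measurable φ) {T : Set (ℝ × ℝ)} (hT : MeasurableSet T) :
    ∫⁻ x : Fin (k + 1) → ℝ, φ (x i) * {x : Fin (k + 1) → ℝ |
        ∀ j, (x i, x (i.succAbove j)) ∈ T}.indicator 1 x ∂(Measure.pi fun _ => P) =
      ∫⁻ a, φ a * P (Prod.mk a ⁻¹' T) ^ k ∂P := by
  have hpres := measurePreserving_piFinSuccAbove (fun _ : Fin (k + 1) => P) i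
  set S : Set (ℝ × (Fin k → ℝ)) := {p | ∀ j, (p.1, p.2 j) ∈ T} with hS
  have hSm : MeasurableSet S := by
    rw [hS, Set.ofPred_forall]
    exact MeasurableSet.iInter fun j =>
      hT.preimage (by fun_prop : Measurable fun p : ℝ × (Fin k → ℝ) => (p.1, p.2 j))
  have hG : Measurable fun p : ℝ × (Fin k → ℝ) => φ p.1 * S.indicator 1 p :=
    (hφ.comp measurable_fst).mul (measurable_one.indicator hSm)
  have h1 : ∀ x : Fin (k + 1) → ℝ, φ (x i) * {x : Fin (k + 1) → ℝ |
      ∀ j, (x i, x (i.succAbove j)) ∈ T}.indicator 1 x =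
      (fun p : ℝ × (Fin k → ℝ) => φ p.1 * S.indicator 1 p)
        (MeasurableEquiv.piFinSuccAbove (fun _ => ℝ) i x) := fun x => rfl
  simp_rw [h1]
  rw [hpres.lintegral_comp hG, lintegral_prod _ hG.aemeasurable]
  refine lintegral_congr fun a => ?_
  have hsec : MeasurableSet (Prod.mk a ⁻¹' S) := hSm.preimage measurable_prodMk_left
  have h2 : ∀ y, S.indicator (1 : ℝ × (Fin k → ℝ) → ℝ≥0∞) (a, y) =
      (Prod.mk a ⁻¹' S).indicator 1 y := fun y => rfl
  simp_rw [h2]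
  rw [lintegral_const_mul _ (measurable_one.indicator hsec), lintegral_indicator_one hsec]
  have h3 : Prod.mk a ⁻¹' S = Set.univ.pi fun _ => Prod.mk a ⁻¹' T := by
    ext y; simp [hS]
  rw [h3, Measure.pi_pi]
  simp

/-- Whichever index is selected is at least as near as every other one; summing over indices
overcounts only ties. -/
lemma IsNearestSelection.lintegral_le {f : ℝ → ℝ} [IsProbabilityMeasure (lawOfDensity f)] {k : ℕ}
    {r : ℝ} {C : (Fin (k + 1) → ℝ) → ℝ} (hC : IsNearestSelection r C) {φ : ℝ → ℝ≥0∞}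
    (hφ : Measurable φ) :
    ∫⁻ x, φ (C x) ∂(sampleLaw f (k + 1)) ≤
      (k + 1) * ∫⁻ a, φ a * lawOfDensity f {z | |a - r| ≤ |z - r|} ^ k ∂(lawOfDensity f) := by
  set T : Set (ℝ × ℝ) := {p | |p.1 - r| ≤ |p.2 - r|}
  have hT : MeasurableSet T := measurableSet_le (by fun_prop) (by fun_prop)
  calc ∫⁻ x, φ (C x) ∂(sampleLaw f (k + 1))
      ≤ ∫⁻ x : Fin (k + 1) → ℝ, ∑ i, φ (x i) * {x : Fin (k + 1) → ℝ |
        ∀ j, (x i, x (i.succAbove j)) ∈ T}.indicator 1 x ∂(sampleLaw f (k + 1)) := by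
        refine lintegral_mono fun x => ?_
        obtain ⟨i, hi⟩ := hC.selects x
        refine le_trans ?_ (Finset.single_le_sum (fun _ _ => zero_le) (Finset.mem_univ i))
        have hmem : x ∈ {x : Fin (k + 1) → ℝ | ∀ j, (x i, x (i.succAbove j)) ∈ T} := fun j => by
          have := hC.nearest x (i.succAbove j)
          rwa [hi] at this
        rw [Set.indicator_of_mem hmem, hi]; simp
    _ = _ := by
        have hm : ∀ i : Fin (k + 1), Measurable fun x : Fin (k + 1) → ℝ => φ (x i) *
            {x : Fin (k + 1) → ℝ | ∀ j, (x i, x (i.succAbove j)) ∈ T}.indicator 1 x := fun i => by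
          refine (hφ.comp (measurable_pi_apply i)).mul (measurable_one.indicator ?_)
          rw [Set.ofPred_forall]
          exact MeasurableSet.iInter fun j => hT.preimage (by fun_prop : Measurable
            fun x : Fin (k + 1) → ℝ => (x i, x (i.succAbove j)))
        rw [lintegral_finsetSum _ fun i _ => hm i]
        simp_rw [lintegral_mul_indicator_forall_succAbove (lawOfDensity f) _ hφ hT]
        simp [T]

/-- An index strictly nearer than all others must carry the selection, and at most one such index
exists. With the matching upper bound this determines the law of `C` whatever the tie-breaking. -/
lemma IsNearestSelection.le_lintegral {f : ℝ → ℝ} [IsProbabilityMeasure (lawOfDensity f)] {k : ℕ}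
    {r : ℝ} {C : (Fin (k + 1) → ℝ) → ℝ} (hC : IsNearestSelection r C) {φ : ℝ → ℝ≥0∞}
    (hφ : Measurable φ) :
    (k + 1) * ∫⁻ a, φ a * lawOfDensity f {z | |a - r| < |z - r|} ^ k ∂(lawOfDensity f) ≤
      ∫⁻ x, φ (C x) ∂(sampleLaw f (k + 1)) := by
  set T : Set (ℝ × ℝ) := {p | |p.1 - r| < |p.2 - r|}
  have hT : MeasurableSet T := measurableSet_lt (by fun_prop) (by fun_prop)
  calc _ = ∫⁻ x : Fin (k + 1) → ℝ, ∑ i, φ (x i) * {x : Fin (k + 1) → ℝ |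
        ∀ j, (x i, x (i.succAbove j)) ∈ T}.indicator 1 x ∂(sampleLaw f (k + 1)) := by
        have hm : ∀ i : Fin (k + 1), Measurable fun x : Fin (k + 1) → ℝ => φ (x i) *
            {x : Fin (k + 1) → ℝ | ∀ j, (x i, x (i.succAbove j)) ∈ T}.indicator 1 x := fun i => by
          refine (hφ.comp (measurable_pi_apply i)).mul (measurable_one.indicator ?_)
          rw [Set.ofPred_forall]
          exact MeasurableSet.iInter fun j => hT.preimage (by fun_prop : Measurable
            fun x : Fin (k + 1) → ℝ => (x i, x (i.succAbove j)))
        rw [lintegral_finsetSum _ fun i _ => hm i]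
        simp_rw [lintegral_mul_indicator_forall_succAbove (lawOfDensity f) _ hφ hT]
        simp [T]
    _ ≤ ∫⁻ x, φ (C x) ∂(sampleLaw f (k + 1)) := by
        refine lintegral_mono fun x => ?_
        obtain ⟨i, hi⟩ := hC.selects x
        rw [Finset.sum_eq_single i]
        · rw [hi]
          refine mul_le_of_le_one_right' ?_
          exact Set.indicator_le_self' (fun _ _ => zero_le) x
        · intro i' _ hne
          rw [Set.indicator_of_notMem, mul_zero]
          intro hmem
          obtain ⟨j, hj⟩ := Fin.exists_succAbove_eq hne.symm
          have h1 := hmem j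
          rw [hj] at h1
          have h2 := hC.nearest x i'
          rw [hi] at h2
          exact absurd h1 (not_lt.2 h2)
        · simp

lemma lawOfDensity_abs_sub_lt_eq (f : ℝ → ℝ) (r d : ℝ) :
    lawOfDensity f {z | d < |z - r|} = lawOfDensity f {z | d ≤ |z - r|} := by
  have hac : lawOfDensity f ≪ volume := withDensity_absolutelyContinuous _ _
  refine le_antisymm (measure_mono fun z (hz : d < |z - r|) => hz.le) ?_
  have hsub : {z | d ≤ |z - r|} ⊆ {z | d < |z - r|} ∪ {r + d, r - d} := fun z hz => by
    rcases (show d ≤ |z - r| from hz).lt_or_eq with h | h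
    · exact Or.inl h
    · right
      rcases abs_choice (z - r) with h' | h'
      · left; linarith
      · right; rw [Set.mem_singleton_iff]; linarith
  refine (measure_mono hsub).trans ((measure_union_le _ _).trans ?_)
  rw [hac ((Set.toFinite {r + d, r - d}).measure_zero volume), add_zero]

/-! ### Strict unimodality and the aligned sender's target -/

lemma IsNoiseDensity.measure_pos {f : ℝ → ℝ} (hf : IsNoiseDensity f) {S : Set ℝ}
    (hS : volume S ≠ 0) : lawOfDensity f S ≠ 0 := fun h => hS <| by
  refine withDensity_absolutelyContinuous' hf.measurable.ennreal_ofReal.aemeasurable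
    (ae_of_all _ fun x => ?_) h
  simpa using hf.pos x

/-- If the density is symmetric and strictly unimodal, a sample nearest to `r > 0` lies below `r` in
expectation. -/
lemma IsNearestSelection.integral_ne_of_pos {f : ℝ → ℝ} (hf : IsNoiseDensity f)
    (hanti : ∀ x y, |x| < |y| → f y < f x) {n : ℕ} [NeZero n] {r : ℝ} (hr : 0 < r)
    {C : (Fin n → ℝ) → ℝ} (hC : IsNearestSelection r C) :
    ∫ x, C x ∂(sampleLaw f n) ≠ r := by
  obtain ⟨k, rfl⟩ := Nat.exists_eq_succ_of_ne_zero (NeZero.ne n)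
  have := hf.isProbabilityMeasure
  intro hmean
  have hCI : Integrable C (sampleLaw f (k + 1)) :=
    (hf.memLp_of_selects hC.measurable hC.selects).integrable (by norm_num)
  have hCr : Integrable (fun x => C x - r) (sampleLaw f (k + 1)) := hCI.sub (integrable_const r)
  have h0 : ∫ x, (C x - r) ∂(sampleLaw f (k + 1)) = 0 := by
    rw [integral_sub hCI (integrable_const r)]
    simpa using sub_eq_zero.2 hmean
  have hfin : ∀ g : (Fin (k + 1) → ℝ) → ℝ, Integrable g (sampleLaw f (k + 1)) →
      ∫⁻ x, ENNReal.ofReal (g x) ∂(sampleLaw f (k + 1)) ≠ ∞ := fun g hg =>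
    ((lintegral_mono fun x => Real.ofReal_le_enorm _).trans_lt hg.2).ne
  have heq : ∫⁻ x, ENNReal.ofReal (C x - r) ∂(sampleLaw f (k + 1)) =
      ∫⁻ x, ENNReal.ofReal (r - C x) ∂(sampleLaw f (k + 1)) := by
    rw [integral_eq_lintegral_pos_part_sub_lintegral_neg_part hCr, sub_eq_zero] at h0
    simpa using (ENNReal.toReal_eq_toReal_iff' (hfin _ hCr) (hfin _ hCr.neg)).1 h0
  -- The density of `C` at `r ± d` is `(k + 1) f (r ± d) w d`: the weight depends on the distance
  -- alone, so the two sides of `r` differ only through `f`.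
  set w : ℝ → ℝ≥0∞ := fun d => lawOfDensity f {z | d ≤ |z - r|} ^ k with hw
  have hwanti : Antitone w := fun d d' hd => by
    simp only [hw]
    gcongr
  have hwm : Measurable w := hwanti.measurable
  have hw0 : ∀ d, w d ≠ 0 := fun d => pow_ne_zero _ (hf.measure_pos (fun h => by
    have hsub : Set.Ici (r + d) ⊆ {z | d ≤ |z - r|} := fun z hz =>
      (by have : r + d ≤ z := hz
          linarith : d ≤ z - r).trans (le_abs_self _)
    have := measure_mono_null hsub h
    simp at this))
  have hwt : ∀ d, w d ≠ ∞ := fun d => ENNReal.pow_ne_top (measure_ne_top _ _)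
  have hfm := hf.measurable
  have hup := hC.lintegral_le (f := f) (φ := fun a => ENNReal.ofReal (a - r)) (by fun_prop)
  have hlo := hC.le_lintegral (f := f) (φ := fun a => ENNReal.ofReal (r - a)) (by fun_prop)
  simp only [lawOfDensity_abs_sub_lt_eq] at hlo
  have h1 : ∫⁻ a, ENNReal.ofReal (a - r) * w |a - r| ∂(lawOfDensity f) =
      ∫⁻ d, ENNReal.ofReal (f (r + d)) * (ENNReal.ofReal d * w |d|) := by
    rw [lawOfDensity, lintegral_withDensity_eq_lintegral_mul _ (by fun_prop) (by fun_prop),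
      ← lintegral_add_right_eq_self _ r]
    simp [add_comm r]
  have h2 : ∫⁻ a, ENNReal.ofReal (r - a) * w |a - r| ∂(lawOfDensity f) =
      ∫⁻ d, ENNReal.ofReal (f (r - d)) * (ENNReal.ofReal d * w |d|) := by
    rw [lawOfDensity, lintegral_withDensity_eq_lintegral_mul _ (by fun_prop) (by fun_prop),
      ← lintegral_sub_left_eq_self _ r]
    simp
  have hkk : ((k : ℝ≥0∞) + 1) ≠ 0 := by simp
  have hkt : ((k : ℝ≥0∞) + 1) ≠ ∞ := by simp
  have hle : ∫⁻ d, ENNReal.ofReal (f (r - d)) * (ENNReal.ofReal d * w |d|) ≤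
      ∫⁻ d, ENNReal.ofReal (f (r + d)) * (ENNReal.ofReal d * w |d|) := by
    rw [← h1, ← h2]
    exact (ENNReal.mul_le_mul_iff_right hkk hkt).1 (hlo.trans (heq.ge.trans hup))
  have hlt : ∀ d, 0 < d → f (r + d) < f (r - d) := fun d hd => hanti _ _ (by
    rw [← sq_lt_sq]; nlinarith [mul_pos hr hd])
  -- Strict monotonicity of the integral needs finiteness; the lower bound for the law of `C` and
  -- integrability of `C - r` supply it.
  have hfinite : ∫⁻ d, ENNReal.ofReal (f (r + d)) * (ENNReal.ofReal d * w |d|) ≠ ∞ := by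
    have hlo' := hC.le_lintegral (f := f) (φ := fun a => ENNReal.ofReal (a - r)) (by fun_prop)
    simp only [lawOfDensity_abs_sub_lt_eq] at hlo'
    rw [← h1]
    intro htop
    have := hlo'.trans_lt (hfin _ hCr).lt_top
    simp only [hw] at htop
    rw [htop, ENNReal.mul_top hkk] at this
    exact lt_irrefl _ this
  refine absurd hle (not_le.2 ?_)
  refine lintegral_strict_mono_of_ae_le_of_ae_lt_on (s := Set.Ioi 0) (by fun_prop) hfinite
    (ae_of_all _ fun d => ?_) (by simp) (ae_of_all _ fun d hd => ?_)
  · rcases le_or_gt d 0 with hd | hd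
    · simp [ENNReal.ofReal_of_nonpos hd]
    · exact mul_le_mul_left (ENNReal.ofReal_le_ofReal (hlt d hd).le) _
  · have hd' : (0 : ℝ) < d := hd
    have hd0 : ENNReal.ofReal d ≠ 0 := by simpa using hd'
    refine (ENNReal.mul_lt_mul_iff_left (mul_ne_zero hd0 (hw0 _))
      (ENNReal.mul_ne_top ENNReal.ofReal_ne_top (hwt _))).2 ?_
    exact (ENNReal.ofReal_lt_ofReal_iff (hf.pos _)).2 (hlt d hd')

/-- A nonzero target is missed on average on the side of the origin, where the density is larger;
reflection covers negative targets. For aligned preferences this determines the equilibrium target.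
-/
lemma IsNearestSelection.eq_zero_of_integral_eq {f : ℝ → ℝ} (hf : IsNoiseDensity f)
    (he : ∀ x, f (-x) = f x) (hanti : ∀ x y, |x| < |y| → f y < f x) {n : ℕ} [NeZero n] {r : ℝ}
    {C : (Fin n → ℝ) → ℝ} (hC : IsNearestSelection r C) (h : ∫ x, C x ∂(sampleLaw f n) = r) :
    r = 0 := by
  rcases lt_trichotomy r 0 with hr | hr | hr
  · obtain ⟨C', hC', hmean, -⟩ := hC.exists_reflection hf he
    exact absurd (by rw [hmean, h]) (hC'.integral_ne_of_pos hf hanti (neg_pos.2 hr))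
  · exact hr
  · exact absurd h (hC.integral_ne_of_pos hf hanti hr)

/-- The bound does not depend on the target. As `r - E C = MS - MR` in equilibrium, a large conflict
of interest therefore forces a large `|r|`. -/
lemma abs_integral_le_of_selects {f : ℝ → ℝ} (hf : IsNoiseDensity f) {n : ℕ}
    {C : (Fin n → ℝ) → ℝ} (hm : Measurable C) (hs : ∀ x, ∃ i, C x = x i) :
    |∫ x, C x ∂(sampleLaw f n)| ≤ ∫ x, ∑ i, |x i| ∂(sampleLaw f n) := by
  have := hf.isProbabilityMeasure
  refine (abs_integral_le_integral_abs).trans (integral_mono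
    ((hf.memLp_of_selects hm hs).integrable (by norm_num)).abs
    (integrable_finsetSum _ fun i _ => ((hf.memLp_eval i).integrable (by norm_num)).abs)
    fun x => ?_)
  obtain ⟨i, hi⟩ := hs x
  simp only [hi]
  exact Finset.single_le_sum (f := fun i => |x i|) (fun j _ => abs_nonneg _) (Finset.mem_univ i)

/-! ### Laplace noise -/

section Laplace

variable {b : ℝ}

lemma laplacePDFReal_pos (hb : 0 < b) (x : ℝ) : 0 < laplacePDFReal b x := by
  unfold laplacePDFReal; positivity

lemma measurable_laplacePDFReal (b : ℝ) : Measurable (laplacePDFReal b) := by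
  unfold laplacePDFReal; fun_prop

lemma laplacePDFReal_neg (b x : ℝ) : laplacePDFReal b (-x) = laplacePDFReal b x := by
  simp [laplacePDFReal]

lemma laplacePDFReal_lt (hb : 0 < b) {x y : ℝ} (h : |x| < |y|) :
    laplacePDFReal b y < laplacePDFReal b x := by
  unfold laplacePDFReal
  gcongr

lemma lawOfDensity_laplace_Ioi (hb : 0 < b) {d : ℝ} (hd : 0 ≤ d) :
    lawOfDensity (laplacePDFReal b) (Set.Ioi d) = ENNReal.ofReal (Real.exp (-(d / b)) / 2) := by
  have hneg : -(1 / b) < 0 := by simpa using hb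
  have hI := integrableOn_exp_mul_Ioi hneg d
  have hval := integral_exp_mul_Ioi hneg d
  rw [lawOfDensity, withDensity_apply _ measurableSet_Ioi]
  have hcongr : ∫⁻ x in Set.Ioi d, ENNReal.ofReal (laplacePDFReal b x) =
      ∫⁻ x in Set.Ioi d, ENNReal.ofReal ((2 * b)⁻¹ * Real.exp (-(1 / b) * x)) := by
    refine setLIntegral_congr_fun measurableSet_Ioi fun x hx => ?_
    have hx' : 0 ≤ x := hd.trans (le_of_lt hx)
    simp only [laplacePDFReal, abs_of_nonneg hx']
    congr 3; ring
  rw [hcongr, ← ofReal_integral_eq_lintegral_ofReal (hI.const_mul _)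
    (ae_of_all _ fun x => by positivity), integral_const_mul, hval]
  congr 1
  have : -(1 / b) * d = -(d / b) := by ring
  rw [this]; field_simp

lemma lawOfDensity_laplace_abs_gt (hb : 0 < b) {d : ℝ} (hd : 0 ≤ d) :
    lawOfDensity (laplacePDFReal b) {x | d < |x|} = ENNReal.ofReal (Real.exp (-(d / b))) := by
  have hpres := measurePreserving_neg_lawOfDensity (measurable_laplacePDFReal b)
    (laplacePDFReal_neg b)
  have hset : {x : ℝ | d < |x|} = Set.Ioi d ∪ (fun x : ℝ => -x) ⁻¹' Set.Ioi d := by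
    ext x; simp only [Set.mem_ofPred_eq, Set.mem_union, Set.mem_preimage, Set.mem_Ioi, lt_abs]
  have hdisj : Disjoint (Set.Ioi d) ((fun x : ℝ => -x) ⁻¹' Set.Ioi d) := by
    rw [Set.disjoint_left]
    intro x (hx : d < x) (hx' : d < -x)
    linarith
  rw [hset, measure_union hdisj (measurableSet_Ioi.preimage measurable_neg),
    hpres.measure_preimage measurableSet_Ioi.nullMeasurableSet, lawOfDensity_laplace_Ioi hb hd,
    ← ENNReal.ofReal_add (by positivity) (by positivity), add_halves]

lemma isNoiseDensity_laplacePDFReal (hb : 0 < b) : IsNoiseDensity (laplacePDFReal b) where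
  measurable := measurable_laplacePDFReal b
  pos := laplacePDFReal_pos hb
  isProbabilityMeasure := ⟨by
    have hac : lawOfDensity (laplacePDFReal b) ≪ volume := withDensity_absolutelyContinuous _ _
    have h0 : lawOfDensity (laplacePDFReal b) {x | (0 : ℝ) < |x|}ᶜ = 0 := by
      refine hac ?_
      have : {x : ℝ | (0 : ℝ) < |x|}ᶜ = {0} := by ext x; simp
      rw [this]; simp
    have hm : MeasurableSet {x : ℝ | (0 : ℝ) < |x|} := measurableSet_lt (by fun_prop) (by fun_prop)
    rw [← measure_add_measure_compl hm, h0, lawOfDensity_laplace_abs_gt hb le_rfl]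
    simp⟩
  memLp := by
    rw [memLp_two_iff_integrable_sq measurable_id.aestronglyMeasurable]
    refine ⟨by fun_prop, ?_⟩
    rw [hasFiniteIntegral_iff_ofReal (ae_of_all _ fun x => sq_nonneg _)]
    have := lintegral_sq_le_of_tail (μ := lawOfDensity (laplacePDFReal b)) (h := fun x => |x|)
      (k := 1 / b) (fun x => abs_nonneg x) (by fun_prop) (by positivity) fun s hs => by
        rw [lawOfDensity_laplace_abs_gt hb hs.le]
        apply le_of_eq; congr 3; ring
    simp only [sq_abs] at this
    exact this.trans_lt ENNReal.ofReal_lt_top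

/-- `|C|` is the minimum of `n` independent exponentials of mean `b`, hence exponential of rate `n /
b`. -/
lemma IsNearestSelection.integral_sq_le_laplace (hb : 0 < b) {n : ℕ} (hn : n ≠ 0)
    {C : (Fin n → ℝ) → ℝ} (hC : IsNearestSelection 0 C) :
    ∫ x, C x ^ 2 ∂(sampleLaw (laplacePDFReal b) n) ≤ 2 * b ^ 2 / n ^ 2 := by
  have hf := isNoiseDensity_laplacePDFReal hb
  have := hf.isProbabilityMeasure
  have hn0 : (0 : ℝ) < n := by positivity
  have hm := hC.measurable
  rw [integral_eq_lintegral_of_nonneg_ae (ae_of_all _ fun x => sq_nonneg _)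
    (hm.pow_const 2).aestronglyMeasurable]
  refine ENNReal.toReal_le_of_le_ofReal (by positivity) ?_
  have key := lintegral_sq_le_of_tail (μ := sampleLaw (laplacePDFReal b) n) (h := fun x => |C x|)
    (k := n / b) (fun x => abs_nonneg _) (by fun_prop) (by positivity) fun s hs => by
      have hsub : {x | s < |C x|} ⊆ Set.univ.pi fun _ : Fin n => {z : ℝ | s < |z|} := by
        intro x hx i _
        have := hC.nearest x i
        rw [sub_zero, sub_zero] at this
        exact lt_of_lt_of_le hx this
      refine (measure_mono hsub).trans (le_of_eq ?_)
      rw [Measure.pi_pi, Finset.prod_const, Finset.card_univ, Fintype.card_fin,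
        lawOfDensity_laplace_abs_gt hb hs.le, ← ENNReal.ofReal_pow (Real.exp_pos _).le,
        ← Real.exp_nat_mul]
      congr 2; ring
  simp only [sq_abs] at key
  refine key.trans (le_of_eq ?_)
  congr 1; field_simp

/-! ### Laplace noise: the variance for extreme targets -/

/-- The Laplace distribution function on the positive half-line. -/
def laplaceCDFPos (b x : ℝ) : ℝ := 1 - Real.exp (-(x / b)) / 2

lemma laplaceCDFPos_le_one (b x : ℝ) : laplaceCDFPos b x ≤ 1 := by
  have := Real.exp_pos (-(x / b)); unfold laplaceCDFPos; linarith

lemma laplaceCDFPos_nonneg (hb : 0 < b) {x : ℝ} (hx : 0 ≤ x) : 0 ≤ laplaceCDFPos b x := by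
  have : Real.exp (-(x / b)) ≤ 1 := Real.exp_le_one_iff.2 (by simpa using by positivity)
  unfold laplaceCDFPos; linarith

lemma hasDerivAt_exp_neg_div (b x : ℝ) :
    HasDerivAt (fun x => Real.exp (-(x / b))) (-(Real.exp (-(x / b)) / b)) x := by
  have h : HasDerivAt (fun x : ℝ => -(x / b)) (-(1 / b)) x := ((hasDerivAt_id x).div_const b).neg
  exact h.exp.congr_deriv (by ring)

/-- The integrand is `(x - c) ^ 2` times the density of the maximum of `k + 1` samples. Beyond `x ≥
0` the noise is exponential with mean `x + b` and variance `b ^ 2`. The variance part integrates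
exactly to `b ^ 2 F ^ (k + 1)`; integrating the squared-mean part by parts leaves a term of
favourable sign, which is dropped. -/
lemma sub_le_integral_laplace (hb : 0 < b) (k : ℕ) (c : ℝ) {r : ℝ} (hr : 0 ≤ r) :
    b ^ 2 * (laplaceCDFPos b r ^ (k + 1) - (1 / 2) ^ (k + 1)) -
        (k + 1) / 2 * Real.exp (-(r / b)) * (r + b - c) ^ 2 ≤
      ∫ x in (0 : ℝ)..r, (k + 1) * (laplacePDFReal b x * ((x - c) ^ 2 * laplaceCDFPos b x ^ k)) := by
  set F := laplaceCDFPos b with hF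
  set E : ℝ → ℝ := fun x => Real.exp (-(x / b)) with hE
  set Ψ : ℝ → ℝ := fun x => b ^ 2 * F x ^ (k + 1) - (k + 1) / 2 * (E x * (x + b - c) ^ 2 * F x ^ k)
    with hΨ
  have hEd : ∀ x, HasDerivAt E (-(E x / b)) x := hasDerivAt_exp_neg_div b
  have hFd : ∀ x, HasDerivAt F (E x / (2 * b)) x := fun x => by
    exact (((hEd x).div_const 2).const_sub 1).congr_deriv (by field_simp)
  have hFp : ∀ (m : ℕ) x, HasDerivAt (fun x => F x ^ m) (m * F x ^ (m - 1) * (E x / (2 * b))) x :=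
    fun m x => (hFd x).pow m
  have hΨd : ∀ x, HasDerivAt Ψ ((k + 1) * ((2 * b)⁻¹ * E x * ((x - c) ^ 2 * F x ^ k)) -
      (k + 1) / 2 * (E x * (x + b - c) ^ 2 * (k * F x ^ (k - 1) * (E x / (2 * b))))) x := by
    intro x
    have h1 : HasDerivAt (fun x : ℝ => (x + b - c) ^ 2) (2 * (x + b - c)) x := by
      have h : HasDerivAt (fun x : ℝ => x + b - c) 1 x :=
        ((hasDerivAt_id x).add_const b).sub_const c
      exact (h.pow 2).congr_deriv (by simp)
    have h2 := ((hFp (k + 1) x).const_mul (b ^ 2)).sub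
      ((((hEd x).mul h1).mul (hFp k x)).const_mul (((k : ℝ) + 1) / 2))
    refine h2.congr_deriv ?_
    rw [Nat.add_sub_cancel]
    simp only [Pi.mul_apply]
    push_cast
    field_simp
    ring
  have hcF : Continuous F := by
    rw [hF]; unfold laplaceCDFPos; fun_prop
  have hcf : Continuous (laplacePDFReal b) := by unfold laplacePDFReal; fun_prop
  have key := intervalIntegral.sub_le_integral_of_hasDeriv_right_of_le (g := Ψ)
    (φ := fun x => (k + 1) * (laplacePDFReal b x * ((x - c) ^ 2 * F x ^ k))) hr
    (fun x _ => (hΨd x).continuousAt.continuousWithinAt)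
    (fun x _ => (hΨd x).hasDerivWithinAt)
    (Continuous.integrableOn_Icc (by fun_prop)) (fun x hx => by
      have hx0 : 0 ≤ x := hx.1.le
      have hE0 : 0 < E x := Real.exp_pos _
      have hF0 : 0 ≤ F x := laplaceCDFPos_nonneg hb hx0
      have h1 : laplacePDFReal b x = (2 * b)⁻¹ * E x := by
        simp only [laplacePDFReal, hE, abs_of_nonneg hx0, neg_div]
      rw [h1]
      have : 0 ≤ (k + 1) / 2 * (E x * (x + b - c) ^ 2 * (k * F x ^ (k - 1) * (E x / (2 * b)))) := by
        positivity
      linarith)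
  refine le_trans ?_ key
  have hF0 : F 0 = 1 / 2 := by simp [hF, laplaceCDFPos]; norm_num
  have hE0 : E 0 = 1 := by simp [hE]
  have h1 : (k + 1) / 2 * (E r * (r + b - c) ^ 2 * F r ^ k) ≤
      (k + 1) / 2 * (E r * (r + b - c) ^ 2 * 1) := by
    have hE0 : 0 < E r := Real.exp_pos _
    have := pow_le_one₀ (n := k) (laplaceCDFPos_nonneg hb hr) (laplaceCDFPos_le_one b r)
    gcongr
  have h2 : 0 ≤ (k + 1) / 2 * (E 0 * (0 + b - c) ^ 2 * F 0 ^ k) := by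
    rw [hF0, hE0]; positivity
  simp only [hΨ]
  rw [hF0] at h2 ⊢
  have h3 : ((k : ℝ) + 1) / 2 * Real.exp (-(r / b)) * (r + b - c) ^ 2 =
      (k + 1) / 2 * (E r * (r + b - c) ^ 2 * 1) := by ring
  rw [h3]
  linarith

/-- A sample point `x` in `(0, r]` with all others below it is nearest to `r`. On this interval the
density of `C` is therefore at least that of the sample maximum. -/
lemma IsNearestSelection.le_integral_sub_sq_laplace (hb : 0 < b) {k : ℕ} {r : ℝ} (hr : 0 ≤ r)
    {C : (Fin (k + 1) → ℝ) → ℝ} (hC : IsNearestSelection r C) (c : ℝ) :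
    b ^ 2 * (laplaceCDFPos b r ^ (k + 1) - (1 / 2) ^ (k + 1)) -
        (k + 1) / 2 * Real.exp (-(r / b)) * (r + b - c) ^ 2 ≤
      ∫ x, (C x - c) ^ 2 ∂(sampleLaw (laplacePDFReal b) (k + 1)) := by
  have hf := isNoiseDensity_laplacePDFReal hb
  set f := laplacePDFReal b with hfdef
  have := hf.isProbabilityMeasure
  have hfm := hf.measurable
  have hcF : Continuous (laplaceCDFPos b) := by unfold laplaceCDFPos; fun_prop
  have hcf : Continuous f := by rw [hfdef]; unfold laplacePDFReal; fun_prop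
  refine (sub_le_integral_laplace hb k c hr).trans ?_
  have hI : Integrable (fun x => (C x - c) ^ 2) (sampleLaw f (k + 1)) :=
    ((hf.memLp_of_selects hC.measurable hC.selects).sub (memLp_const c)).integrable_sq
  rw [← ENNReal.ofReal_le_ofReal_iff (integral_nonneg fun x => sq_nonneg _),
    ofReal_integral_eq_lintegral_ofReal hI (ae_of_all _ fun x => sq_nonneg _)]
  refine le_trans ?_ (hC.le_lintegral (f := f) (φ := fun a => ENNReal.ofReal ((a - c) ^ 2))
    (by fun_prop))
  rw [intervalIntegral.integral_const_mul, ENNReal.ofReal_mul (by positivity)]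
  have hk : ENNReal.ofReal ((k : ℝ) + 1) = k + 1 := by
    rw [ENNReal.ofReal_add (by positivity) zero_le_one]; simp
  rw [hk]
  gcongr
  simp only [lawOfDensity_abs_sub_lt_eq]
  have hwanti : Antitone fun d => lawOfDensity f {z | d ≤ |z - r|} ^ k := fun d d' hd => by
    dsimp only
    gcongr
  have hwm := hwanti.measurable
  have hwm' : Measurable fun a => lawOfDensity f {z | |a - r| ≤ |z - r|} ^ k :=
    hwm.comp (by fun_prop : Measurable fun a : ℝ => |a - r|)
  rw [intervalIntegral.integral_of_le hr, ofReal_integral_eq_lintegral_ofReal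
    (by
      have : Continuous fun x => f x * ((x - c) ^ 2 * laplaceCDFPos b x ^ k) := by fun_prop
      exact (this.integrableOn_Icc (a := 0) (b := r)).mono_set Set.Ioc_subset_Icc_self)
    (by
      filter_upwards [ae_restrict_mem measurableSet_Ioc] with x hx
      have := laplaceCDFPos_nonneg hb hx.1.le
      have := (hf.pos x).le
      positivity)]
  obtain ⟨w, hw⟩ : ∃ w : ℝ → ℝ≥0∞, ∀ a, lawOfDensity f {z | |a - r| ≤ |z - r|} ^ k = w a :=
    ⟨_, fun _ => rfl⟩
  simp_rw [hw] at hwm' ⊢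
  conv_rhs => rw [lawOfDensity]
  rw [lintegral_withDensity_eq_lintegral_mul _ (by fun_prop) (by fun_prop)]
  refine le_trans ?_ (setLIntegral_le_lintegral (Set.Ioc 0 r) _)
  refine setLIntegral_mono (by fun_prop) fun x hx => ?_
  have hF0 := laplaceCDFPos_nonneg hb hx.1.le
  rw [Pi.mul_apply, ENNReal.ofReal_mul (hf.pos x).le, ENNReal.ofReal_mul (sq_nonneg _),
    ENNReal.ofReal_pow hF0, ← hw]
  gcongr
  have hsub : (Set.Ioi x)ᶜ ⊆ {z | |x - r| ≤ |z - r|} := fun z hz => by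
    have hz' : z ≤ x := not_lt.1 hz
    have := hx.2
    simp only [Set.mem_ofPred_eq]
    rw [abs_of_nonpos (by linarith), abs_of_nonpos (by linarith)]
    linarith
  refine le_trans (le_of_eq ?_) (measure_mono hsub)
  rw [prob_compl_eq_one_sub measurableSet_Ioi, lawOfDensity_laplace_Ioi hb hx.1.le,
    laplaceCDFPos, ENNReal.ofReal_sub _ (by positivity), ENNReal.ofReal_one]

/-- With Laplace noise, nearest-sample selections with an extreme target have a large variance. -/
theorem exists_forall_lt_variance_laplace (hb : 0 < b) {n : ℕ} (hn : 2 ≤ n) :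
    ∃ R : ℝ, ∀ (r : ℝ) (C : (Fin n → ℝ) → ℝ), R < |r| → IsNearestSelection r C →
      b ^ 2 / 2 < ∫ x, (C x - ∫ x', C x' ∂(sampleLaw (laplacePDFReal b) n)) ^ 2
        ∂(sampleLaw (laplacePDFReal b) n) := by
  obtain ⟨k, rfl⟩ := Nat.exists_eq_succ_of_ne_zero (show n ≠ 0 by omega)
  have hf := isNoiseDensity_laplacePDFReal hb
  have := hf.isProbabilityMeasure
  set f := laplacePDFReal b with hfdef
  set A := ∫ x, ∑ i, |x i| ∂(sampleLaw f (k + 1)) with hA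
  -- Since `|E C| ≤ A` for every target, putting `-A` for the centre gives the worst case once `r ≥
  -- 0`. The exponential beats the square, leaving `b ^ 2 (1 - (1 / 2) ^ (k + 1))`, at least `3 b ^
  -- 2 / 4` for two or more samples.
  have hlim : Filter.Tendsto (fun r => b ^ 2 * (laplaceCDFPos b r ^ (k + 1) - (1 / 2) ^ (k + 1)) -
      (k + 1) / 2 * Real.exp (-(r / b)) * (r + b + A) ^ 2) Filter.atTop
      (nhds (b ^ 2 * ((1 - 0 / 2) ^ (k + 1) - (1 / 2) ^ (k + 1)) -
        (k + 1) / 2 * (b ^ 2 * Real.exp ((b + A) / b)) * 0)) := by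
    have hdiv : Filter.Tendsto (fun r : ℝ => r / b) Filter.atTop Filter.atTop :=
      Filter.tendsto_id.atTop_div_const hb
    have hexp : Filter.Tendsto (fun r : ℝ => Real.exp (-(r / b))) Filter.atTop (nhds 0) :=
      Real.tendsto_exp_neg_atTop_nhds_zero.comp hdiv
    have hu : Filter.Tendsto (fun r : ℝ => (r + (b + A)) / b) Filter.atTop Filter.atTop :=
      (Filter.tendsto_atTop_add_const_right _ (b + A) Filter.tendsto_id).atTop_div_const hb
    have hpoly := (Real.tendsto_pow_mul_exp_neg_atTop_nhds_zero 2).comp hu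
    refine Filter.Tendsto.sub ((((hexp.div_const 2).const_sub 1).pow (k + 1)).sub_const _
      |>.const_mul _) ?_
    refine (hpoly.const_mul ((k + 1) / 2 * (b ^ 2 * Real.exp ((b + A) / b)))).congr fun r => ?_
    have : Real.exp (-(r / b)) = Real.exp ((b + A) / b) * Real.exp (-((r + (b + A)) / b)) := by
      rw [← Real.exp_add]; congr 1; ring
    simp only [Function.comp]
    rw [this]
    field_simp
    ring
  have hlt : b ^ 2 / 2 < b ^ 2 * ((1 - 0 / 2) ^ (k + 1) - (1 / 2) ^ (k + 1)) -
        (k + 1) / 2 * (b ^ 2 * Real.exp ((b + A) / b)) * 0 := by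
    have h1 : ((1 : ℝ) / 2) ^ (k + 1) ≤ (1 / 2) ^ 2 :=
      pow_le_pow_of_le_one (by norm_num) (by norm_num) hn
    have h2 : 0 < b ^ 2 := by positivity
    norm_num at h1 ⊢
    nlinarith
  obtain ⟨R, hR⟩ := Filter.eventually_atTop.1 (hlim.eventually_const_lt hlt)
  have key : ∀ (r : ℝ) (C : (Fin (k + 1) → ℝ) → ℝ), 0 ≤ r → R ≤ r → IsNearestSelection r C →
      b ^ 2 / 2 < ∫ x, (C x - ∫ x', C x' ∂(sampleLaw f (k + 1))) ^ 2 ∂(sampleLaw f (k + 1)) := by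
    intro r C hr0 hr hC
    refine (hR r hr).trans_le (le_trans ?_ (hC.le_integral_sub_sq_laplace hb hr0 _))
    have h1 := (abs_le.1 (abs_integral_le_of_selects hf hC.measurable hC.selects)).1
    have h2 := (abs_le.1 (abs_integral_le_of_selects hf hC.measurable hC.selects)).2
    rw [← hA] at h1 h2
    have h3 : (r + b - ∫ x, C x ∂(sampleLaw f (k + 1))) ^ 2 ≤ (r + b + A) ^ 2 :=
      sq_le_sq' (by linarith) (by linarith)
    gcongr
  refine ⟨R, fun r C hr hC => ?_⟩
  rcases le_total 0 r with h | h
  · rw [abs_of_nonneg h] at hr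
    exact key r C h hr.le hC
  · rw [abs_of_nonpos h] at hr
    obtain ⟨C', hC', -, hvar⟩ := hC.exists_reflection hf (laplacePDFReal_neg b)
    rw [← hvar]
    exact key (-r) C' (by linarith) hr.le hC'

/-- The losses are separated by `b ^ 2 / 2`: the aligned sender's target is `0`, so `n₀ ≥ 2` keeps
that loss at or below the threshold, while a sufficiently biased expert has an extreme target and
exceeds it. -/
theorem exists_forall_receiverPrefers_laplace (hb : 0 < b) {n₀ n : ℕ} (hn₀ : 2 ≤ n₀)
    (hn : n₀ < n) : ∃ Δ₀ : ℝ, 0 < Δ₀ ∧ ∀ MR MS : ℝ, Δ₀ < |MS - MR| →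
      ReceiverPrefers (laplacePDFReal b) foresight MR n₀ MR n MS := by
  have hf := isNoiseDensity_laplacePDFReal hb
  obtain ⟨R, hR⟩ := exists_forall_lt_variance_laplace hb (show 2 ≤ n by omega)
  set f := laplacePDFReal b with hfdef
  set A := ∫ x, ∑ i, |x i| ∂(sampleLaw f n) with hA
  -- From `|MS - MR| ≤ |r'| + A`, a conflict above `R + A` gives `|r'| > R`; the `1` only ensures
  -- positivity.
  refine ⟨max (R + A) 1, by positivity, fun MR MS hΔ =>
    ⟨exists_isTranslationInvariantPBE hf (by omega) MR MR,
      exists_isTranslationInvariantPBE hf (by omega) MS MR, fun π α π' α' h h' θ => ?_⟩⟩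
  obtain ⟨r, C, hC, hr, hu⟩ := h.exists_selection hf
  obtain ⟨r', C', hC', hr', hu'⟩ := h'.exists_selection hf
  have : NeZero n₀ := ⟨by omega⟩
  rw [hu, hu', neg_lt_neg_iff]
  have hmean : ∫ x, C x ∂(sampleLaw f n₀) = r := by linarith
  have hr0 := hC.eq_zero_of_integral_eq hf (laplacePDFReal_neg b)
    (fun x y => laplacePDFReal_lt hb) hmean
  subst hr0
  have hle : ∫ x, C x ^ 2 ∂(sampleLaw f n₀) ≤ b ^ 2 / 2 := by
    refine (hC.integral_sq_le_laplace hb (by omega)).trans ?_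
    have h2 : (2 : ℝ) ≤ n₀ := by exact_mod_cast hn₀
    rw [div_le_div_iff₀ (by positivity) (by norm_num)]
    nlinarith [sq_nonneg b, mul_le_mul_of_nonneg_left (mul_le_mul h2 h2 (by norm_num)
      (by positivity)) (sq_nonneg b)]
  simp only [hmean, sub_zero]
  refine hle.trans_lt (hR r' C' ?_ hC')
  have h1 := abs_integral_le_of_selects hf hC'.measurable hC'.selects
  have h2 := abs_sub r' (∫ x, C' x ∂(sampleLaw f n))
  rw [hr'] at h2
  have h3 := (le_max_left (R + A) 1).trans_lt hΔ
  linarith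

end Laplace

end Anecdotes

end

theorem mainTheorem3 :
    (∀ v : ℝ≥0, v ≠ 0 → ∀ n₀ : ℕ, 1 ≤ n₀ →
      ∃ n₁ : ℕ, ∀ n : ℕ, n₀ < n → n₁ < n → ∀ MR MS : ℝ, MS ≠ MR →
        Anecdotes.ReceiverPrefers (gaussianPDFReal 0 v) Anecdotes.foresight MR n MS n₀ MR) ∧
    (∀ b : ℝ, 0 < b → ∀ n₀ : ℕ, 2 ≤ n₀ → ∀ n : ℕ, n₀ < n →
      ∃ Δ₀ : ℝ, 0 < Δ₀ ∧ ∀ MR MS : ℝ, Δ₀ < |MS - MR| →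
        Anecdotes.ReceiverPrefers (Anecdotes.laplacePDFReal b) Anecdotes.foresight
          MR n₀ MR n MS) :=
  ⟨fun _ hv _ hn₀ =>
    let ⟨n₁, h⟩ := Anecdotes.exists_forall_receiverPrefers_gaussian hv hn₀
    ⟨n₁, fun n hn hn' MR MS _ => h n hn hn' MR MS⟩,
  fun _ hb _ hn₀ _ hn => Anecdotes.exists_forall_receiverPrefers_laplace hb hn₀ hn⟩
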